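/- Let $X\in\mathbb R^{n\times p}$ have nonzero columns, $y\in\mathbb R^n$. Consider the Lasso $\min_\beta \frac1{2n}\|y-X\beta\|_2^2+\sum_j e^{\lambda}|\beta_j|$ with $\lambda\in\mathbb R$, or the weighted Lasso $\min_\beta \frac1{2n}\|y-X\beta\|_2^2+\sum_j e^{\lambda_j}|\beta_j|$ with $\lambda\in\mathbb R^p$ (below, $\lambda_j=\lambda$ for the Lasso). Assume that the minimizer $\hat\beta$ is unique for the given $\lambda$. Let $\hat S=\{j_1<\dots<j_{\hat s}\}$ be its support and $M=X_{:,\hat S}^\top X_{:,\hat S}$. For a positive definite matrix $A$ put $\|x\|_A=\sqrt{x^\top A^{-1}x}$, so that $\|x\|_{M^{-1}}=\sqrt{x^\top Mx}$. The limit Jacobian $\hat J$ is as follows. For the Lasso, $\hat J\in\mathbb R^p$ with $\hat J_{\hat S}=-ne^\lambda M^{-1}\operatorname{sign}\hat\beta_{\hat S}$ and $\hat J_{\hat S^c}=0$. For the weighted Lasso, $\hat J\in\mathbb R^{p\times p}$ with $\hat J_{\hat S,\hat S}=-M^{-1}\operatorname{diag}(ne^{\lambda_{\hat S}}\odot\operatorname{sign}\hat\beta_{\hat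 S})$ and all other entries $0$. With $\mathrm{ST}(t,\tau)=\operatorname{sign}(t)(|t|-\tau)_+$ (and $\operatorname{sign}0=0$), consider the following schemes; the rows $J_j$ are scalars and $d_j=e^\lambda$ for the Lasso, while $J_j=J_{j,:}$ and $d_j=e^{\lambda_j}e_j^\top$ for the weighted Lasso. (F) Forward differentiation of BCD, from arbitrary $(\beta^{(0)},J^{(0)})$: in each epoch, for $j=1,\dots,p$ in turn, $$\beta_j\leftarrow \mathrm{ST}\Big(\beta_j+\tfrac{X_{:,j}^\top(y-X\beta)}{\|X_{:,j}\|^2},\tfrac{ne^{\lambda_j}}{\|X_{:,j}\|^2}\Big),\qquad J_j\leftarrow|\operatorname{sign}\beta_j|\Big(J_j-\tfrac{X_{:,j}^\top XJ}{\|X_{:,j}\|^2}\Big)-\tfrac{n\operatorname{sign}\beta_j}{\|X_{:,j}\|^2}\,d_j ,$$ the second update using the new $\beta_j$. (D) The decoupled "implicit forward" scheme: given the output $b\in\mathbb R^p$ of a (weighted) Lasso solver, start from $J^{(0)}=0$ and in each epoch, for $j$ in the support of $b$ in increasing order, apply the above update of $J_j$ with $\operatorname{sign}b_j$ in place of $\operatorname{sign}\beta_j$,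 all rows (and, for the weighted Lasso, all columns) being restricted to the support of $b$. (I) Forward differentiation of ISTA, from arbitrary $(\beta^{(0)},J^{(0)})$: for all $j$ simultaneously, the updates of (F) with $\|X_{:,j}\|^2$ replaced by $\|X\|_2^2$ (the old $\beta$ and $J$ being used on the right-hand sides, except in $\operatorname{sign}\beta_j$, where $\beta_j$ is the new one). Then $M\succ0$ and the following hold. 1. In (F) and (I), $\beta^{(k)}\to\hat\beta$. If $|X_{:,j}^\top(y-X\hat\beta)|<ne^{\lambda_j}$ for all $j\notin\hat S$, then the support and the signs are identified after finitely many steps: $\operatorname{sign}\beta^{(k)}=\operatorname{sign}\hat\beta$ for all large $k$. Whenever the support is identified, i.e. $\operatorname{supp}\beta^{(k)}=\hat S$ for all large $k$, one has $J^{(k)}\to\hat J$. 2. Let $$C=\|A^{(j_{\hat s})}\cdots A^{(j_1)}\|_2,\qquad A^{(j)}=\mathrm{Id}_{\hat s}-\frac{(M^{1/2})_{:,j}}{\|X_{:,j}\|}\,\frac{(M^{1/2})_{j,:}}{\|X_{:,j}\|}.$$ Then $C<1$. In (F), if $k_0\ge1$ and $\operatorname{sign}\beta^{(k)}=\operatorname{sign}\hat\beta$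 for all $k\ge k_0$, then for all $k\ge k_0$ and $m\ge 0$ one has $J^{(k)}_{\hat S^c}=0$, $$\|J^{(k+1)}_{\hat S}-\hat J_{\hat S}\|_{M^{-1}}\le C\,\|J^{(k)}_{\hat S}-\hat J_{\hat S}\|_{M^{-1}},\qquad \|J^{(k_0+m)}_{\hat S}-\hat J_{\hat S}\|_{M^{-1}}\le C^m\|J^{(k_0)}_{\hat S}-\hat J_{\hat S}\|_{M^{-1}} .$$ For the weighted Lasso these two inequalities hold with $J_{\hat S}-\hat J_{\hat S}$ replaced by $(J_{\hat S,:}-\hat J_{\hat S,:})v$, for every $v\in\mathbb R^p$. 3. In (D), if $\operatorname{sign}b=\operatorname{sign}\hat\beta$ (in particular if $b=\hat\beta$), then $J^{(k)}\to\hat J$, the entries of $J^{(k)}$ with an index outside $\hat S$ are $0$, and the inequalities of 2 hold with the same $C$ and $k_0=0$. 4. In (I), the statement of 2 holds with the Euclidean norm in place of $\|\cdot\|_{M^{-1}}$ and with $C$ replaced by $1-\nu/\|X\|_2^2$, where $\nu$ is the smallest eigenvalue of $M$; if $\hat S\neq\emptyset$, this constant lies in $[0,1)$. (If $\hat S=\emptyset$,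 both sides of the inequalities are $0$.) -/

import Mathlib

open Matrix Filter Topology

noncomputable section

namespace LassoDiff

/-! ### The Lasso and the weighted Lasso -/

/-- Lasso objective `(1/2n) ‖y - Xβ‖² + e^lam ‖β‖₁`. -/
def lassoObj {n p : ℕ} (X : Matrix (Fin n) (Fin p) ℝ) (y : Fin n → ℝ) (lam : ℝ)
    (β : Fin p → ℝ) : ℝ :=
  1 / (2 * (n : ℝ)) * ∑ i, (y i - (X *ᵥ β) i) ^ 2 + Real.exp lam * ∑ j, |β j|

/-- Weighted Lasso objective `(1/2n) ‖y - Xβ‖² + ∑ j, e^(lam j) |β j|`. -/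
def wLassoObj {n p : ℕ} (X : Matrix (Fin n) (Fin p) ℝ) (y : Fin n → ℝ) (lam : Fin p → ℝ)
    (β : Fin p → ℝ) : ℝ :=
  1 / (2 * (n : ℝ)) * ∑ i, (y i - (X *ᵥ β) i) ^ 2 + ∑ j, Real.exp (lam j) * |β j|

/-- `βhat` is the one and only minimizer of `f`. -/
def IsUniqueMinimizer {p : ℕ} (f : (Fin p → ℝ) → ℝ) (βhat : Fin p → ℝ) : Prop :=
  (∀ β, f βhat ≤ f β) ∧ ∀ β', (∀ β, f β' ≤ f β) → β' = βhat

/-- The support of a vector: the indices of its nonzero coefficients. -/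
def supp {p : ℕ} (β : Fin p → ℝ) : Finset (Fin p) := Finset.univ.filter fun j => β j ≠ 0

/-- The vector of componentwise signs, with `sign 0 = 0`. -/
def signVec {p : ℕ} (β : Fin p → ℝ) : Fin p → ℝ := fun j => Real.sign (β j)

/-- Soft-thresholding `ST(t, τ) = sign t * (|t| - τ)₊`. -/
def softThreshold (t τ : ℝ) : ℝ := Real.sign t * max (|t| - τ) 0

/-- Squared Euclidean norm of the `j`-th column of `X`. -/
def colSq {n p : ℕ} (X : Matrix (Fin n) (Fin p) ℝ) (j : Fin p) : ℝ := ∑ i, X i j ^ 2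

/-- The restriction `X_{:,S}` of the design to the columns in `S`. -/
def colsOn {n p : ℕ} (X : Matrix (Fin n) (Fin p) ℝ) (S : Finset (Fin p)) :
    Matrix (Fin n) S ℝ := X.submatrix id (fun j : S => (j : Fin p))

/-- The matrix `X_{:,S}ᵀ X_{:,S}`. -/
def gramOn {n p : ℕ} (X : Matrix (Fin n) (Fin p) ℝ) (S : Finset (Fin p)) :
    Matrix S S ℝ := (colsOn X S)ᵀ * colsOn X S

/-- Strict complementarity of `βhat`, for the penalty with weights `w`:
`|X_{:,j}ᵀ (y - X βhat)| < n w_j` for every `j` with `βhat_j = 0`. -/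
def StrictlyComplementary {n p : ℕ} (X : Matrix (Fin n) (Fin p) ℝ) (y : Fin n → ℝ)
    (w : Fin p → ℝ) (βhat : Fin p → ℝ) : Prop :=
  ∀ j, βhat j = 0 → |X.col j ⬝ᵥ (y - X *ᵥ βhat)| < n * w j

/-! ### The limiting Jacobians -/

/-- Jacobian of the Lasso (one hyperparameter):
`-n e^lam (X_Sᵀ X_S)⁻¹ sign(βhat_S)` on the support `S` of `βhat`, and `0` off `S`. -/
def lassoJac {n p : ℕ} (X : Matrix (Fin n) (Fin p) ℝ) (lam : ℝ) (βhat : Fin p → ℝ) :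
    Fin p → ℝ := fun j =>
  if hj : j ∈ supp βhat then
    -(n * Real.exp lam) *
      ((gramOn X (supp βhat))⁻¹ *ᵥ fun l : supp βhat => Real.sign (βhat l)) ⟨j, hj⟩
  else 0

/-- Jacobian of the weighted Lasso (`p` hyperparameters):
`-(X_Sᵀ X_S)⁻¹ diag(n e^(lam_S) ⊙ sign βhat_S)` on `S × S`, and `0` elsewhere. -/
def wLassoJac {n p : ℕ} (X : Matrix (Fin n) (Fin p) ℝ) (lam : Fin p → ℝ)
    (βhat : Fin p → ℝ) : Matrix (Fin p) (Fin p) ℝ := fun j₁ j₂ =>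
  if h : j₁ ∈ supp βhat ∧ j₂ ∈ supp βhat then
    -((gramOn X (supp βhat))⁻¹ * Matrix.diagonal fun l : supp βhat =>
        n * Real.exp (lam l) * Real.sign (βhat l)) ⟨j₁, h.1⟩ ⟨j₂, h.2⟩
  else 0

/-! ### Forward differentiation of block coordinate descent

The auxiliary variables `r = y - Xβ` and `dr = -XJ` that the pseudo-code updates incrementally
are written out here. -/

/-- Coordinate descent update of `β_j`, for the penalty `∑ j, w_j |β_j|`. -/
def bcdUpdate {n p : ℕ} (X : Matrix (Fin n) (Fin p) ℝ) (y : Fin n → ℝ) (w : Fin p → ℝ)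
    (j : Fin p) (β : Fin p → ℝ) : Fin p → ℝ :=
  Function.update β j
    (softThreshold (β j + X.col j ⬝ᵥ (y - X *ᵥ β) / colSq X j) (n * w j / colSq X j))

/-- One coordinate step of the forward scheme for the Lasso: update `β_j`, then `J_j`
with the sign of the new `β_j`. -/
def lassoFwdStep {n p : ℕ} (X : Matrix (Fin n) (Fin p) ℝ) (y : Fin n → ℝ) (lam : ℝ)
    (s : (Fin p → ℝ) × (Fin p → ℝ)) (j : Fin p) : (Fin p → ℝ) × (Fin p → ℝ) :=
  let β := bcdUpdate X y (fun _ => Real.exp lam) j s.1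
  let J := s.2
  let dr := -(X *ᵥ J)
  (β, Function.update J j
    (|Real.sign (β j)| * (J j + X.col j ⬝ᵥ dr / colSq X j)
      - n * Real.exp lam / colSq X j * Real.sign (β j)))

/-- The pair (coefficients, Jacobian) after `k` epochs of the forward scheme for the Lasso,
started at `(β₀, J₀)`; an epoch visits the coordinates in increasing order. -/
def lassoFwd {n p : ℕ} (X : Matrix (Fin n) (Fin p) ℝ) (y : Fin n → ℝ) (lam : ℝ)
    (β₀ J₀ : Fin p → ℝ) (k : ℕ) : (Fin p → ℝ) × (Fin p → ℝ) :=
  (fun s => (List.finRange p).foldl (lassoFwdStep X y lam) s)^[k] (β₀, J₀)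

/-- One coordinate step of the forward scheme for the weighted Lasso: update `β_j`, then the
row `J_{j,:}` with the sign of the new `β_j`. -/
def wLassoFwdStep {n p : ℕ} (X : Matrix (Fin n) (Fin p) ℝ) (y : Fin n → ℝ)
    (lam : Fin p → ℝ) (s : (Fin p → ℝ) × Matrix (Fin p) (Fin p) ℝ) (j : Fin p) :
    (Fin p → ℝ) × Matrix (Fin p) (Fin p) ℝ :=
  let β := bcdUpdate X y (fun l => Real.exp (lam l)) j s.1
  let J := s.2
  let dr := -(X * J)
  (β, J.updateRow j fun l =>
    |Real.sign (β j)| * (J j l + (X.col j ᵥ* dr) l / colSq X j)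
      - if l = j then n * Real.exp (lam j) / colSq X j * Real.sign (β j) else 0)

/-- The pair (coefficients, Jacobian) after `k` epochs of the forward scheme for the weighted
Lasso, started at `(β₀, J₀)`. -/
def wLassoFwd {n p : ℕ} (X : Matrix (Fin n) (Fin p) ℝ) (y : Fin n → ℝ)
    (lam : Fin p → ℝ) (β₀ : Fin p → ℝ) (J₀ : Matrix (Fin p) (Fin p) ℝ) (k : ℕ) :
    (Fin p → ℝ) × Matrix (Fin p) (Fin p) ℝ :=
  (fun s => (List.finRange p).foldl (wLassoFwdStep X y lam) s)^[k] (β₀, J₀)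

/-! ### The decoupled (implicit forward) scheme

Its input `b` is the vector returned by the Lasso solver; the Jacobian starts at `0` and the
coordinates in the support of `b` are visited in increasing order. -/

/-- One coordinate step of the decoupled scheme for the Lasso. -/
def lassoImpStep {n p : ℕ} (X : Matrix (Fin n) (Fin p) ℝ) (lam : ℝ) (b : Fin p → ℝ)
    (J : Fin p → ℝ) (j : Fin p) : Fin p → ℝ :=
  let dr := -(colsOn X (supp b) *ᵥ fun l : supp b => J l)
  Function.update J j
    (J j + (X.col j ⬝ᵥ dr / colSq X j - n * Real.exp lam / colSq X j * Real.sign (b j)))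

/-- The Jacobian after `k` epochs of the decoupled scheme for the Lasso. -/
def lassoImp {n p : ℕ} (X : Matrix (Fin n) (Fin p) ℝ) (lam : ℝ) (b : Fin p → ℝ) (k : ℕ) :
    Fin p → ℝ :=
  (fun J => ((supp b).sort (· ≤ ·)).foldl (lassoImpStep X lam b) J)^[k] 0

/-- One coordinate step of the decoupled scheme for the weighted Lasso: only the entries
`J_{j,l}` with `l` in the support of `b` are updated. -/
def wLassoImpStep {n p : ℕ} (X : Matrix (Fin n) (Fin p) ℝ) (lam : Fin p → ℝ)
    (b : Fin p → ℝ) (J : Matrix (Fin p) (Fin p) ℝ) (j : Fin p) :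
    Matrix (Fin p) (Fin p) ℝ :=
  let dr : Matrix (Fin n) (supp b) ℝ :=
    -(colsOn X (supp b) * J.submatrix (fun l : supp b => (l : Fin p)) (fun l : supp b => (l : Fin p)))
  J.updateRow j fun l =>
    (if hl : l ∈ supp b then J j l + (X.col j ᵥ* dr) ⟨l, hl⟩ / colSq X j else J j l)
      - if l = j then n * Real.exp (lam j) / colSq X j * Real.sign (b j) else 0

/-- The Jacobian after `k` epochs of the decoupled scheme for the weighted Lasso. -/
def wLassoImp {n p : ℕ} (X : Matrix (Fin n) (Fin p) ℝ) (lam : Fin p → ℝ) (b : Fin p → ℝ)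
    (k : ℕ) : Matrix (Fin p) (Fin p) ℝ :=
  (fun J => ((supp b).sort (· ≤ ·)).foldl (wLassoImpStep X lam b) J)^[k] 0

/-! ### Norms and rates -/

open scoped Matrix.Norms.L2Operator in
/-- The spectral norm `‖M‖₂`, i.e. the operator norm between Euclidean spaces. -/
def specNorm {ι κ : Type} [Fintype ι] [Fintype κ] [DecidableEq κ]
    (M : Matrix ι κ ℝ) : ℝ := ‖M‖

/-- The Mahalanobis norm `‖x‖_A = √(xᵀ A⁻¹ x)`. -/
def mahalanobis {ι : Type} [Fintype ι] [DecidableEq ι] (A : Matrix ι ι ℝ) (x : ι → ℝ) : ℝ :=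
  Real.sqrt (x ⬝ᵥ (A⁻¹ *ᵥ x))

open scoped MatrixOrder Matrix.Norms.L2Operator in
/-- The positive semidefinite square root `(X_Sᵀ X_S)^(1/2)`. -/
def gramSqrt {n p : ℕ} (X : Matrix (Fin n) (Fin p) ℝ) (S : Finset (Fin p)) :
    Matrix S S ℝ := CFC.sqrt (gramOn X S)

/-- The matrix `A^(j) = Id - (G_{:,j} / ‖X_{:,j}‖) (G_{j,:} / ‖X_{:,j}‖)`,
where `G = (X_Sᵀ X_S)^(1/2)`. -/
def stepMat {n p : ℕ} (X : Matrix (Fin n) (Fin p) ℝ) (S : Finset (Fin p)) (j : S) :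
    Matrix S S ℝ :=
  1 - Matrix.vecMulVec (fun a => gramSqrt X S a j / Real.sqrt (colSq X j))
        (fun a => gramSqrt X S j a / Real.sqrt (colSq X j))

/-- The constant `C = ‖A^(j_s) ⋯ A^(j_1)‖₂`, where `j_1 < ⋯ < j_s` are the elements of `S`. -/
def bcdRate {n p : ℕ} (X : Matrix (Fin n) (Fin p) ℝ) (S : Finset (Fin p)) : ℝ :=
  specNorm (List.ofFn fun i : Fin S.card => stepMat X S (S.orderIsoOfFin rfl i)).reverse.prod

/-- From index `k₀` on, the nonnegative quantities `e k` contract by the factor `c` at each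
step; consequently they are at most `c ^ m * e k₀` after `m` further steps. -/
def LinearFrom (e : ℕ → ℝ) (c : ℝ) (k₀ : ℕ) : Prop :=
  ∀ m, e (k₀ + m + 1) ≤ c * e (k₀ + m) ∧ e (k₀ + m) ≤ c ^ m * e k₀

/-- The vector `J_S - Jhat_S`, measured in the Mahalanobis norm of `(X_Sᵀ X_S)⁻¹`. -/
def lassoErr {n p : ℕ} (X : Matrix (Fin n) (Fin p) ℝ) (S : Finset (Fin p))
    (J Jhat : Fin p → ℝ) : ℝ :=
  mahalanobis (gramOn X S)⁻¹ fun j : S => J j - Jhat j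

/-- The vector `(J - Jhat)_{S,:} v`, measured in the Mahalanobis norm of `(X_Sᵀ X_S)⁻¹`. -/
def wLassoErr {n p : ℕ} (X : Matrix (Fin n) (Fin p) ℝ) (S : Finset (Fin p))
    (J Jhat : Matrix (Fin p) (Fin p) ℝ) (v : Fin p → ℝ) : ℝ :=
  mahalanobis (gramOn X S)⁻¹ fun j : S => ((J - Jhat) *ᵥ v) j

/-! ### Forward differentiation of ISTA (proximal gradient descent, step size `1/‖X‖₂²`) -/

/-- One ISTA step for the penalty `∑ j, w_j |β_j|`. -/
def istaStep {n p : ℕ} (X : Matrix (Fin n) (Fin p) ℝ) (y : Fin n → ℝ) (w : Fin p → ℝ)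
    (β : Fin p → ℝ) : Fin p → ℝ := fun j =>
  softThreshold (β j + X.col j ⬝ᵥ (y - X *ᵥ β) / specNorm X ^ 2) (n * w j / specNorm X ^ 2)

/-- Coefficients and Jacobian after `k` steps of forward differentiated ISTA for the Lasso. -/
def lassoIsta {n p : ℕ} (X : Matrix (Fin n) (Fin p) ℝ) (y : Fin n → ℝ) (lam : ℝ)
    (β₀ J₀ : Fin p → ℝ) (k : ℕ) : (Fin p → ℝ) × (Fin p → ℝ) :=
  (fun s : (Fin p → ℝ) × (Fin p → ℝ) =>
    let β := istaStep X y (fun _ => Real.exp lam) s.1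
    (β, fun j => |Real.sign (β j)| * (s.2 j - (Xᵀ *ᵥ (X *ᵥ s.2)) j / specNorm X ^ 2)
      - n * Real.exp lam / specNorm X ^ 2 * Real.sign (β j)))^[k] (β₀, J₀)

/-- Coefficients and Jacobian after `k` steps of forward differentiated ISTA for the weighted
Lasso. -/
def wLassoIsta {n p : ℕ} (X : Matrix (Fin n) (Fin p) ℝ) (y : Fin n → ℝ)
    (lam : Fin p → ℝ) (β₀ : Fin p → ℝ) (J₀ : Matrix (Fin p) (Fin p) ℝ) (k : ℕ) :
    (Fin p → ℝ) × Matrix (Fin p) (Fin p) ℝ :=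
  (fun s : (Fin p → ℝ) × Matrix (Fin p) (Fin p) ℝ =>
    let β := istaStep X y (fun l => Real.exp (lam l)) s.1
    (β, Matrix.of fun j l =>
      |Real.sign (β j)| * (s.2 j l - (Xᵀ * (X * s.2)) j l / specNorm X ^ 2)
        - if l = j then n * Real.exp (lam j) / specNorm X ^ 2 * Real.sign (β j) else 0))^[k]
    (β₀, J₀)

/-- The constant `1 - ν / ‖X‖₂²`, where `ν` is the smallest eigenvalue of `X_Sᵀ X_S`. -/
def istaRate {n p : ℕ} (X : Matrix (Fin n) (Fin p) ℝ) (S : Finset (Fin p)) : ℝ :=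
  1 - sInf (spectrum ℝ (gramOn X S)) / specNorm X ^ 2

/-- Euclidean norm. -/
def euclNorm {ι : Type} [Fintype ι] (x : ι → ℝ) : ℝ := Real.sqrt (∑ i, x i ^ 2)

end LassoDiff

end

open LassoDiff

noncomputable section

namespace LassoDiff

/-! ### Soft-thresholding -/

theorem softThreshold_eq {t τ : ℝ} (hτ : 0 ≤ τ) :
    softThreshold t τ = max (t - τ) 0 - max (-t - τ) 0 := by
  unfold softThreshold
  rcases lt_trichotomy t 0 with h | h | h
  · rw [Real.sign_of_neg h, abs_of_neg h, max_eq_right (by linarith : t - τ ≤ 0)]; ring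
  · subst h; simp
  · rw [Real.sign_of_pos h, abs_of_pos h, max_eq_right (by linarith : -t - τ ≤ 0)]; ring

theorem softThreshold_prox {u τ : ℝ} (hτ : 0 ≤ τ) (t : ℝ) :
    (u - softThreshold u τ) * (t - softThreshold u τ) ≤ τ * (|t| - |softThreshold u τ|) := by
  have ht := le_abs_self t
  have ht' := neg_abs_le t
  rw [softThreshold_eq hτ]
  rcases le_total (u - τ) 0 with h1 | h1 <;> rcases le_total (-u - τ) 0 with h2 | h2
  · rw [max_eq_right h1, max_eq_right h2]
    simp only [sub_zero, abs_zero]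
    have : |u| ≤ τ := abs_le.2 ⟨by linarith, by linarith⟩
    calc u * t ≤ |u * t| := le_abs_self _
      _ = |u| * |t| := abs_mul _ _
      _ ≤ τ * |t| := by gcongr
  · rw [max_eq_right h1, max_eq_left h2, zero_sub, abs_neg, abs_of_nonneg h2]
    nlinarith
  · rw [max_eq_left h1, max_eq_right h2, sub_zero, abs_of_nonneg h1]
    nlinarith
  · have hu : u = 0 := by linarith
    have hτ0 : τ = 0 := by linarith
    subst hu hτ0; simp

theorem softThreshold_eq_of_forall_le {b g c τ : ℝ} (hc : 0 < c) (hτ : 0 ≤ τ)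
    (h : ∀ t, g * (t - b) ≤ τ * (|t| - |b|)) : softThreshold (b + g / c) (τ / c) = b := by
  set z := softThreshold (b + g / c) (τ / c) with hz
  have h1 := softThreshold_prox (u := b + g / c) (div_nonneg hτ hc.le) b
  rw [← hz] at h1
  have h2 := h z
  have h3 : (c * b + g - c * z) * (b - z) ≤ τ * (|b| - |z|) := by
    have := mul_le_mul_of_nonneg_left h1 hc.le
    calc _ = c * ((b + g / c - z) * (b - z)) := by field_simp
      _ ≤ _ := this
      _ = _ := by field_simp
  have h4 : c * (b - z) ^ 2 ≤ 0 := by nlinarith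
  have h5 : (b - z) ^ 2 = 0 :=
    le_antisymm (nonpos_of_mul_nonpos_right h4 hc) (sq_nonneg _)
  have : b - z = 0 := pow_eq_zero_iff two_ne_zero |>.1 h5
  linarith

theorem forall_le_of_softThreshold_eq {b g c τ : ℝ} (hc : 0 < c) (hτ : 0 ≤ τ)
    (h : softThreshold (b + g / c) (τ / c) = b) (t : ℝ) : g * (t - b) ≤ τ * (|t| - |b|) := by
  have h1 := softThreshold_prox (u := b + g / c) (div_nonneg hτ hc.le) t
  rw [h] at h1
  have := mul_le_mul_of_nonneg_left h1 hc.le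
  calc _ = c * ((b + g / c - b) * (t - b)) := by field_simp; ring
    _ ≤ _ := this
    _ = _ := by field_simp

/-- The increment of a soft-thresholding step: the penalty pays for the linear term. -/
theorem softThreshold_step_le {b g c τ : ℝ} (hc : 0 < c) (hτ : 0 ≤ τ) :
    τ * (|softThreshold (b + g / c) (τ / c)| - |b|)
        - g * (softThreshold (b + g / c) (τ / c) - b)
      ≤ -(c * (softThreshold (b + g / c) (τ / c) - b) ^ 2) := by
  set z := softThreshold (b + g / c) (τ / c) with hz
  have h1 := softThreshold_prox (u := b + g / c) (div_nonneg hτ hc.le) b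
  rw [← hz] at h1
  have h3 : (c * b + g - c * z) * (b - z) ≤ τ * (|b| - |z|) := by
    have := mul_le_mul_of_nonneg_left h1 hc.le
    calc _ = c * ((b + g / c - z) * (b - z)) := by field_simp
      _ ≤ _ := this
      _ = _ := by field_simp
  nlinarith

theorem continuous_softThreshold {τ : ℝ} (hτ : 0 ≤ τ) :
    Continuous fun t => softThreshold t τ := by
  simp only [softThreshold_eq hτ]
  fun_prop

theorem softThreshold_eq_zero {t τ : ℝ} (h : |t| ≤ τ) : softThreshold t τ = 0 := by
  unfold softThreshold
  rw [max_eq_right (by linarith), mul_zero]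

/-! ### The least squares objective with a weighted `ℓ¹` penalty -/

variable {n p : ℕ}

/-- The objective `½ ‖y - Xβ‖² + ∑ j, τ_j |β_j|`. -/
def penLSq (X : Matrix (Fin n) (Fin p) ℝ) (y : Fin n → ℝ) (τ β : Fin p → ℝ) : ℝ :=
  1 / 2 * ∑ i, (y i - (X *ᵥ β) i) ^ 2 + ∑ j, τ j * |β j|

theorem penLSq_add (X : Matrix (Fin n) (Fin p) ℝ) (y : Fin n → ℝ) (τ β δ : Fin p → ℝ) :
    penLSq X y τ (β + δ) - penLSq X y τ β =
      1 / 2 * ∑ i, (X *ᵥ δ) i ^ 2 +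
        ∑ j, (τ j * (|(β + δ) j| - |β j|) - X.col j ⬝ᵥ (y - X *ᵥ β) * δ j) := by
  have h1 : ∑ j, X.col j ⬝ᵥ (y - X *ᵥ β) * δ j = ∑ i, (y i - (X *ᵥ β) i) * (X *ᵥ δ) i := by
    simp only [dotProduct, mulVec, Finset.sum_mul, Finset.mul_sum, Matrix.col_apply, Pi.sub_apply]
    rw [Finset.sum_comm]
    refine Finset.sum_congr rfl fun i _ => Finset.sum_congr rfl fun j _ => ?_
    ring
  have h2 : ∑ i, (y i - (X *ᵥ (β + δ)) i) ^ 2 =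
      ∑ i, (y i - (X *ᵥ β) i) ^ 2 - 2 * ∑ i, (y i - (X *ᵥ β) i) * (X *ᵥ δ) i
        + ∑ i, (X *ᵥ δ) i ^ 2 := by
    rw [Finset.mul_sum, ← Finset.sum_sub_distrib, ← Finset.sum_add_distrib]
    refine Finset.sum_congr rfl fun i _ => ?_
    rw [mulVec_add, Pi.add_apply]; ring
  simp only [penLSq, Finset.sum_sub_distrib, mul_sub, h1, h2]
  ring

theorem continuous_penLSq (X : Matrix (Fin n) (Fin p) ℝ) (y : Fin n → ℝ) (τ : Fin p → ℝ) :
    Continuous (penLSq X y τ) := by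
  unfold penLSq
  have : Continuous fun β : Fin p → ℝ => X *ᵥ β :=
    Continuous.matrix_mulVec continuous_const continuous_id
  have h : ∀ i, Continuous fun β : Fin p → ℝ => (X *ᵥ β) i := fun i => (continuous_apply i).comp this
  fun_prop

theorem isCompact_penLSq_sublevel (X : Matrix (Fin n) (Fin p) ℝ) (y : Fin n → ℝ) {τ : Fin p → ℝ}
    (hτ : ∀ j, 0 < τ j) (a : ℝ) : IsCompact {β | penLSq X y τ β ≤ a} := by
  refine (isCompact_univ_pi fun j => isCompact_Icc (a := -(a / τ j)) (b := a / τ j)).of_isClosed_subset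
    (isClosed_le (continuous_penLSq X y τ) continuous_const) ?_
  intro β hβ j _
  have h1 : τ j * |β j| ≤ ∑ j, τ j * |β j| :=
    Finset.single_le_sum (f := fun j => τ j * |β j|)
      (fun l _ => mul_nonneg (hτ l).le (abs_nonneg _)) (Finset.mem_univ j)
  have h2 : 0 ≤ 1 / 2 * ∑ i, (y i - (X *ᵥ β) i) ^ 2 := by positivity
  have h3 : penLSq X y τ β ≤ a := hβ
  unfold penLSq at h3
  have : |β j| ≤ a / τ j := by
    rw [le_div_iff₀ (hτ j)]; linarith
  exact abs_le.1 this

/-- First-order optimality for `penLSq`, as a variational inequality in each coordinate. -/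
def IsStationary (X : Matrix (Fin n) (Fin p) ℝ) (y : Fin n → ℝ) (τ β : Fin p → ℝ) : Prop :=
  ∀ j t, X.col j ⬝ᵥ (y - X *ᵥ β) * (t - β j) ≤ τ j * (|t| - |β j|)

theorem IsStationary.le {X : Matrix (Fin n) (Fin p) ℝ} {y : Fin n → ℝ} {τ β : Fin p → ℝ}
    (h : IsStationary X y τ β) (β' : Fin p → ℝ) : penLSq X y τ β ≤ penLSq X y τ β' := by
  have h1 := penLSq_add X y τ β (β' - β)
  rw [add_sub_cancel] at h1
  have h2 : 0 ≤ ∑ j, (τ j * (|β' j| - |β j|) - X.col j ⬝ᵥ (y - X *ᵥ β) * (β' - β) j) :=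
    Finset.sum_nonneg fun j _ => sub_nonneg.2 (h j (β' j))
  have h3 : 0 ≤ 1 / 2 * ∑ i, (X *ᵥ (β' - β)) i ^ 2 := by positivity
  linarith

theorem colSq_pos {X : Matrix (Fin n) (Fin p) ℝ} (hX : ∀ j, X.col j ≠ 0) (j : Fin p) :
    0 < colSq X j := by
  unfold colSq
  obtain ⟨i, hi⟩ := Function.ne_iff.1 (hX j)
  exact Finset.sum_pos' (fun _ _ => sq_nonneg _) ⟨i, Finset.mem_univ _, by
    have : X i j ≠ 0 := hi
    positivity⟩

/-! ### Descent of coordinate descent and of ISTA -/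

theorem bcdUpdate_descent {X : Matrix (Fin n) (Fin p) ℝ} (hX : ∀ j, X.col j ≠ 0) (y : Fin n → ℝ)
    {w : Fin p → ℝ} (hw : ∀ j, 0 ≤ n * w j) (j : Fin p) (β : Fin p → ℝ) :
    penLSq X y (fun j => n * w j) (bcdUpdate X y w j β) +
      1 / 2 * (colSq X j * (bcdUpdate X y w j β j - β j) ^ 2) ≤ penLSq X y (fun j => n * w j) β := by
  set z := bcdUpdate X y w j β j with hz
  have hz' : z = softThreshold (β j + X.col j ⬝ᵥ (y - X *ᵥ β) / colSq X j)
      (n * w j / colSq X j) := by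
    simp [hz, bcdUpdate]
  have hb : bcdUpdate X y w j β = β + Pi.single j (z - β j) := by
    ext l
    by_cases hl : l = j
    · subst hl; simp [hz]
    · simp [bcdUpdate, hl]
  have h1 := penLSq_add X y (fun j => n * w j) β (Pi.single j (z - β j))
  rw [← hb] at h1
  have h2 : ∑ i, (X *ᵥ Pi.single j (z - β j)) i ^ 2 = colSq X j * (z - β j) ^ 2 := by
    simp only [mulVec_single, colSq, Finset.sum_mul]
    refine Finset.sum_congr rfl fun i _ => ?_
    simp [mul_pow]
  have h3 : ∑ l, (n * w l * (|bcdUpdate X y w j β l| - |β l|)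
        - X.col l ⬝ᵥ (y - X *ᵥ β) * (Pi.single j (z - β j) : Fin p → ℝ) l) =
      n * w j * (|z| - |β j|) - X.col j ⬝ᵥ (y - X *ᵥ β) * (z - β j) := by
    rw [Finset.sum_eq_single j]
    · simp [hz]
    · intro l _ hl
      simp [bcdUpdate, hl]
    · simp
  have h4 := softThreshold_step_le (b := β j) (g := X.col j ⬝ᵥ (y - X *ᵥ β))
    (colSq_pos hX j) (hw j)
  rw [← hz'] at h4
  rw [h2, h3] at h1
  linarith

theorem sum_sq_mulVec_le (X : Matrix (Fin n) (Fin p) ℝ) (x : Fin p → ℝ) :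
    ∑ i, (X *ᵥ x) i ^ 2 ≤ specNorm X ^ 2 * ∑ j, x j ^ 2 := by
  have h := Matrix.l2_opNorm_mulVec X (WithLp.toLp 2 x)
  have h2 := mul_self_le_mul_self (norm_nonneg _) h
  rw [← pow_two, ← pow_two, mul_pow, EuclideanSpace.real_norm_sq_eq, EuclideanSpace.real_norm_sq_eq] at h2
  exact h2

theorem istaStep_descent {X : Matrix (Fin n) (Fin p) ℝ} (hX : 0 < specNorm X ^ 2) (y : Fin n → ℝ)
    {w : Fin p → ℝ} (hw : ∀ j, 0 ≤ n * w j) (β : Fin p → ℝ) :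
    penLSq X y (fun j => n * w j) (istaStep X y w β) +
      1 / 2 * (specNorm X ^ 2 * ∑ j, (istaStep X y w β j - β j) ^ 2) ≤
        penLSq X y (fun j => n * w j) β := by
  have h1 := penLSq_add X y (fun j => n * w j) β (istaStep X y w β - β)
  rw [add_sub_cancel] at h1
  have h2 := sum_sq_mulVec_le X (istaStep X y w β - β)
  have h3 : ∑ j, (n * w j * (|istaStep X y w β j| - |β j|)
        - X.col j ⬝ᵥ (y - X *ᵥ β) * (istaStep X y w β - β) j) ≤
      ∑ j, -(specNorm X ^ 2 * (istaStep X y w β j - β j) ^ 2) :=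
    Finset.sum_le_sum fun j _ => softThreshold_step_le hX (hw j)
  rw [Finset.sum_neg_distrib, ← Finset.mul_sum] at h3
  simp only [Pi.sub_apply] at h1 h2 h3
  linarith

/-! ### Convergence of descent iterations -/

/-- A continuous map that strictly decreases a continuous function with compact sublevel sets,
except at a single point, has all its orbits converging to this point. -/
theorem tendsto_iterate_of_descent {E : Type*} [TopologicalSpace E] [FirstCountableTopology E]
    {F : E → ℝ} {T : E → E} {x₀ : E}
    (hF : Continuous F) (hT : Continuous T) (hK : ∀ a, IsCompact {x | F x ≤ a})
    (hmin : ∀ x, F x₀ ≤ F x) (hle : ∀ x, F (T x) ≤ F x) (heq : ∀ x, F (T x) = F x → x = x₀)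
    (x : E) : Tendsto (fun k => T^[k] x) atTop (𝓝 x₀) := by
  have hanti : Antitone fun k => F (T^[k] x) := antitone_nat_of_succ_le fun k => by
    rw [Function.iterate_succ_apply']; exact hle _
  have hlim := tendsto_atTop_ciInf hanti ⟨F x₀, by rintro _ ⟨k, rfl⟩; exact hmin _⟩
  refine (hK (F x)).tendsto_nhds_of_unique_mapClusterPt
    (Eventually.of_forall fun k => hanti (Nat.zero_le k)) fun a _ ha => heq a ?_
  obtain ⟨φ, hφ, hφa⟩ := ha.tendsto_subseq
  have h1 := tendsto_nhds_unique ((hF.tendsto a).comp hφa) (hlim.comp hφ.tendsto_atTop)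
  have h2 := tendsto_nhds_unique (((hF.comp hT).tendsto a).comp hφa)
    ((hlim.comp ((tendsto_add_atTop_nat 1).comp hφ.tendsto_atTop)).congr fun k => by
      simp [Function.iterate_succ_apply'])
  exact h2.trans h1.symm

/-- An epoch of coordinate descent. -/
def bcdEpoch (X : Matrix (Fin n) (Fin p) ℝ) (y : Fin n → ℝ) (w : Fin p → ℝ) (l : List (Fin p))
    (β : Fin p → ℝ) : Fin p → ℝ :=
  l.foldl (fun β j => bcdUpdate X y w j β) β

theorem continuous_mulVec_residual (X : Matrix (Fin n) (Fin p) ℝ) (y : Fin n → ℝ) (j : Fin p) :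
    Continuous fun β : Fin p → ℝ => X.col j ⬝ᵥ (y - X *ᵥ β) := by
  have : Continuous fun β : Fin p → ℝ => X *ᵥ β :=
    Continuous.matrix_mulVec continuous_const continuous_id
  exact Continuous.dotProduct continuous_const (continuous_const.sub this)

theorem continuous_bcdUpdate {X : Matrix (Fin n) (Fin p) ℝ} (hX : ∀ j, X.col j ≠ 0)
    (y : Fin n → ℝ) {w : Fin p → ℝ} (hw : ∀ j, 0 ≤ n * w j) (j : Fin p) :
    Continuous (bcdUpdate X y w j) := by
  refine continuous_id.update j ?_
  have h := continuous_mulVec_residual X y j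
  exact (continuous_softThreshold (div_nonneg (hw j) (colSq_pos hX j).le)).comp
    ((continuous_apply j).add (h.div_const _))

theorem continuous_istaStep (X : Matrix (Fin n) (Fin p) ℝ)
    (y : Fin n → ℝ) {w : Fin p → ℝ} (hw : ∀ j, 0 ≤ n * w j) :
    Continuous (istaStep X y w) := by
  refine continuous_pi fun j => ?_
  have h := continuous_mulVec_residual X y j
  exact (continuous_softThreshold (div_nonneg (hw j) (sq_nonneg _))).comp
    ((continuous_apply j).add (h.div_const _))

theorem continuous_bcdEpoch {X : Matrix (Fin n) (Fin p) ℝ} (hX : ∀ j, X.col j ≠ 0)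
    (y : Fin n → ℝ) {w : Fin p → ℝ} (hw : ∀ j, 0 ≤ n * w j) (l : List (Fin p)) :
    Continuous (bcdEpoch X y w l) := by
  induction l with
  | nil => exact continuous_id
  | cons j l ih => exact ih.comp (continuous_bcdUpdate hX y hw j)

theorem bcdUpdate_eq_of_penLSq_eq {X : Matrix (Fin n) (Fin p) ℝ} (hX : ∀ j, X.col j ≠ 0)
    {y : Fin n → ℝ} {w : Fin p → ℝ} (hw : ∀ j, 0 ≤ n * w j) {j : Fin p} {β : Fin p → ℝ}
    (h : penLSq X y (fun j => n * w j) β ≤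
      penLSq X y (fun j => n * w j) (bcdUpdate X y w j β)) : bcdUpdate X y w j β = β := by
  have h1 := bcdUpdate_descent hX y hw j β
  have h2 : colSq X j * (bcdUpdate X y w j β j - β j) ^ 2 ≤ 0 := by linarith
  have h3 : bcdUpdate X y w j β j = β j := by
    by_contra hne
    have := mul_pos (colSq_pos hX j) (sq_pos_of_ne_zero (sub_ne_zero.2 hne))
    linarith
  ext l
  by_cases hl : l = j
  · rw [hl, h3]
  · simp [bcdUpdate, hl]

theorem bcdEpoch_descent {X : Matrix (Fin n) (Fin p) ℝ} (hX : ∀ j, X.col j ≠ 0) (y : Fin n → ℝ)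
    {w : Fin p → ℝ} (hw : ∀ j, 0 ≤ n * w j) (l : List (Fin p)) (β : Fin p → ℝ) :
    penLSq X y (fun j => n * w j) (bcdEpoch X y w l β) ≤ penLSq X y (fun j => n * w j) β ∧
    (penLSq X y (fun j => n * w j) (bcdEpoch X y w l β) = penLSq X y (fun j => n * w j) β →
      ∀ j ∈ l, bcdUpdate X y w j β = β) := by
  induction l generalizing β with
  | nil => exact ⟨le_rfl, by simp⟩
  | cons j l ih =>
    have h1 := bcdUpdate_descent hX y hw j β
    have h2 : 0 ≤ 1 / 2 * (colSq X j * (bcdUpdate X y w j β j - β j) ^ 2) := by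
      have := colSq_pos hX j
      positivity
    have h3 := ih (bcdUpdate X y w j β)
    change _ ≤ _ ∧ (penLSq X y _ (bcdEpoch X y w l (bcdUpdate X y w j β)) = _ → _)
    refine ⟨h3.1.trans (by linarith), fun he => ?_⟩
    have h4 := bcdUpdate_eq_of_penLSq_eq hX hw (he.symm.le.trans h3.1)
    rw [h4] at h3 he
    intro i hi
    rcases List.mem_cons.1 hi with rfl | hi
    · exact h4
    · exact h3.2 he i hi

theorem isStationary_of_bcdUpdate {X : Matrix (Fin n) (Fin p) ℝ} (hX : ∀ j, X.col j ≠ 0)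
    {y : Fin n → ℝ} {w : Fin p → ℝ} (hw : ∀ j, 0 ≤ n * w j) {β : Fin p → ℝ}
    (h : ∀ j, bcdUpdate X y w j β = β) : IsStationary X y (fun j => n * w j) β := fun j t => by
  refine forall_le_of_softThreshold_eq (colSq_pos hX j) (hw j) ?_ t
  simpa [bcdUpdate] using congrFun (h j) j

theorem IsStationary.bcdUpdate_eq {X : Matrix (Fin n) (Fin p) ℝ} (hX : ∀ j, X.col j ≠ 0)
    {y : Fin n → ℝ} {w : Fin p → ℝ} (hw : ∀ j, 0 ≤ n * w j) {β : Fin p → ℝ}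
    (h : IsStationary X y (fun j => n * w j) β) (j : Fin p) : bcdUpdate X y w j β = β := by
  have := softThreshold_eq_of_forall_le (colSq_pos hX j) (hw j) (h j)
  simp only [bcdUpdate, this, Function.update_eq_self]

theorem IsUniqueMinimizer.isStationary {X : Matrix (Fin n) (Fin p) ℝ} (hX : ∀ j, X.col j ≠ 0)
    {y : Fin n → ℝ} {w : Fin p → ℝ} (hw : ∀ j, 0 ≤ n * w j) {β : Fin p → ℝ}
    (h : IsUniqueMinimizer (penLSq X y fun j => n * w j) β) :
    IsStationary X y (fun j => n * w j) β :=
  isStationary_of_bcdUpdate hX hw fun _ => bcdUpdate_eq_of_penLSq_eq hX hw (h.1 _)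

theorem IsUniqueMinimizer.tendsto_bcdEpoch {X : Matrix (Fin n) (Fin p) ℝ} (hX : ∀ j, X.col j ≠ 0)
    {y : Fin n → ℝ} {w : Fin p → ℝ} (hw : ∀ j, 0 < n * w j) {βhat : Fin p → ℝ}
    (h : IsUniqueMinimizer (penLSq X y fun j => n * w j) βhat) (β : Fin p → ℝ) :
    Tendsto (fun k => (bcdEpoch X y w (List.finRange p))^[k] β) atTop (𝓝 βhat) := by
  have hw' := fun j => (hw j).le
  exact tendsto_iterate_of_descent (continuous_penLSq X y _) (continuous_bcdEpoch hX y hw' _)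
    (isCompact_penLSq_sublevel X y hw) h.1 (fun β => (bcdEpoch_descent hX y hw' _ β).1)
    (fun β hβ => h.2 _ (isStationary_of_bcdUpdate hX hw'
      fun j => (bcdEpoch_descent hX y hw' _ β).2 hβ j (List.mem_finRange j)).le) β

theorem specNorm_sq_pos {X : Matrix (Fin n) (Fin p) ℝ} (hX : ∀ j, X.col j ≠ 0) (j : Fin p) :
    0 < specNorm X ^ 2 := by
  have h := sum_sq_mulVec_le X (Pi.single j 1)
  have h1 : ∑ i, (X *ᵥ Pi.single j 1) i ^ 2 = colSq X j := by
    simp [colSq]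
  have h2 : ∑ l, (Pi.single j 1 : Fin p → ℝ) l ^ 2 = 1 := by
    rw [Finset.sum_eq_single j] <;> simp +contextual
  rw [h1, h2, mul_one] at h
  exact (colSq_pos hX j).trans_le h

theorem IsUniqueMinimizer.tendsto_istaStep {X : Matrix (Fin n) (Fin p) ℝ} (hX : ∀ j, X.col j ≠ 0)
    {y : Fin n → ℝ} {w : Fin p → ℝ} (hw : ∀ j, 0 < n * w j) {βhat : Fin p → ℝ}
    (h : IsUniqueMinimizer (penLSq X y fun j => n * w j) βhat) (β : Fin p → ℝ) :
    Tendsto (fun k => (istaStep X y w)^[k] β) atTop (𝓝 βhat) := by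
  have hw' := fun j => (hw j).le
  rcases isEmpty_or_nonempty (Fin p) with hp | ⟨⟨j₀⟩⟩
  · exact tendsto_const_nhds.congr fun _ => Subsingleton.elim _ _
  have hL := specNorm_sq_pos hX j₀
  refine tendsto_iterate_of_descent (continuous_penLSq X y _) (continuous_istaStep X y hw')
    (isCompact_penLSq_sublevel X y hw) h.1 (fun β => ?_) (fun β hβ => ?_) β
  · have := istaStep_descent hL y hw' β
    have h2 : 0 ≤ 1 / 2 * (specNorm X ^ 2 * ∑ j, (istaStep X y w β j - β j) ^ 2) := by positivity
    linarith
  · have h1 := istaStep_descent hL y hw' β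
    have h2 : specNorm X ^ 2 * ∑ j, (istaStep X y w β j - β j) ^ 2 ≤ 0 := by linarith
    have h3 : ∑ j, (istaStep X y w β j - β j) ^ 2 = 0 :=
      le_antisymm (nonpos_of_mul_nonpos_right h2 hL) (by positivity)
    rw [Finset.sum_eq_zero_iff_of_nonneg fun _ _ => sq_nonneg _] at h3
    refine h.2 _ (IsStationary.le fun j t => ?_)
    exact forall_le_of_softThreshold_eq hL (hw' j)
      (sub_eq_zero.1 (pow_eq_zero_iff two_ne_zero |>.1 (h3 j (Finset.mem_univ j)))) t

/-! ### Finite identification of the signs -/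

theorem eventually_sign_eq {ι : Type*} {l : Filter ι} {f : ι → ℝ} {a : ℝ} (ha : a ≠ 0)
    (hf : Tendsto f l (𝓝 a)) : ∀ᶠ k in l, Real.sign (f k) = Real.sign a := by
  rcases lt_or_gt_of_ne ha with h | h
  · filter_upwards [hf.eventually (gt_mem_nhds h)] with k hk
    rw [Real.sign_of_neg hk, Real.sign_of_neg h]
  · filter_upwards [hf.eventually (lt_mem_nhds h)] with k hk
    rw [Real.sign_of_pos hk, Real.sign_of_pos h]

theorem eventually_softThreshold_eq_zero {E : Type*} [TopologicalSpace E] {f : E → ℝ} {x : E}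
    (hf : ContinuousAt f x) {τ : ℝ} (h : |f x| < τ) : ∀ᶠ x' in 𝓝 x, softThreshold (f x') τ = 0 := by
  filter_upwards [hf.abs.eventually (gt_mem_nhds h)] with x' hx'
  exact softThreshold_eq_zero hx'.le

theorem signVec_eq_of_supp_eq {b : ℕ → Fin p → ℝ} {βhat : Fin p → ℝ}
    (hb : Tendsto b atTop (𝓝 βhat)) (h : ∀ᶠ k in atTop, supp (b k) = supp βhat) :
    ∀ᶠ k in atTop, signVec (b k) = signVec βhat := by
  have h1 : ∀ j, ∀ᶠ k in atTop, Real.sign (b k j) = Real.sign (βhat j) := fun j => by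
    by_cases hj : βhat j = 0
    · filter_upwards [h] with k hk
      have : j ∉ supp (b k) := by rw [hk]; simp [supp, hj]
      have : b k j = 0 := by simpa [supp] using this
      rw [this, hj]
    · exact eventually_sign_eq hj (tendsto_pi_nhds.1 hb j)
  filter_upwards [eventually_all.2 h1] with k hk
  exact funext hk

theorem bcdEpoch_apply_of_notMem (X : Matrix (Fin n) (Fin p) ℝ) (y : Fin n → ℝ) (w : Fin p → ℝ)
    {l : List (Fin p)} {j : Fin p} (hj : j ∉ l) (β : Fin p → ℝ) : bcdEpoch X y w l β j = β j := by
  induction l generalizing β with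
  | nil => rfl
  | cons i l ih =>
    simp only [List.mem_cons, not_or] at hj
    change bcdEpoch X y w l (bcdUpdate X y w i β) j = β j
    rw [ih hj.2]
    simp [bcdUpdate, hj.1]

theorem eventually_bcdEpoch_eq_zero {X : Matrix (Fin n) (Fin p) ℝ} (hX : ∀ j, X.col j ≠ 0)
    {y : Fin n → ℝ} {w : Fin p → ℝ} (hw : ∀ j, 0 ≤ n * w j) {βhat : Fin p → ℝ}
    (h : IsStationary X y (fun j => n * w j) βhat) {j : Fin p} (hj : βhat j = 0)
    (hs : |X.col j ⬝ᵥ (y - X *ᵥ βhat)| < n * w j) {l : List (Fin p)} (hl : l.Nodup)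
    (hjl : j ∈ l) : ∀ᶠ β in 𝓝 βhat, bcdEpoch X y w l β j = 0 := by
  induction l with
  | nil => simp at hjl
  | cons i l ih =>
    rw [List.nodup_cons] at hl
    have hc := (continuous_bcdUpdate hX y hw i).tendsto βhat
    by_cases hij : i = j
    · subst hij
      have h1 := eventually_softThreshold_eq_zero (x := βhat)
        (f := fun β : Fin p → ℝ => β i + X.col i ⬝ᵥ (y - X *ᵥ β) / colSq X i)
        (τ := n * w i / colSq X i)
        ((continuous_apply i).add ((continuous_mulVec_residual X y i).div_const _)).continuousAt
        (by
          have hcp := colSq_pos hX i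
          rw [hj, zero_add, abs_div, abs_of_pos hcp]
          exact div_lt_div_of_pos_right hs hcp)
      filter_upwards [h1] with β hβ
      change bcdEpoch X y w l (bcdUpdate X y w i β) i = 0
      rw [bcdEpoch_apply_of_notMem X y w hl.1]
      simpa [bcdUpdate] using hβ
    · rw [h.bcdUpdate_eq hX hw i] at hc
      exact hc.eventually (ih hl.2 ((List.mem_cons.1 hjl).resolve_left (Ne.symm hij)))

theorem StrictlyComplementary.eventually_signVec_bcdEpoch {X : Matrix (Fin n) (Fin p) ℝ}
    (hX : ∀ j, X.col j ≠ 0) {y : Fin n → ℝ} {w : Fin p → ℝ} (hw : ∀ j, 0 < n * w j)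
    {βhat : Fin p → ℝ} (h : IsUniqueMinimizer (penLSq X y fun j => n * w j) βhat)
    (hs : StrictlyComplementary X y w βhat) (β : Fin p → ℝ) :
    ∀ᶠ k in atTop,
      signVec ((bcdEpoch X y w (List.finRange p))^[k] β) = signVec βhat := by
  have hw' := fun j => (hw j).le
  have ht := h.tendsto_bcdEpoch hX hw β
  have h1 : ∀ j, ∀ᶠ k in atTop,
      Real.sign ((bcdEpoch X y w (List.finRange p))^[k] β j) = Real.sign (βhat j) := fun j => by
    by_cases hj : βhat j = 0
    · have := ht.eventually (eventually_bcdEpoch_eq_zero hX hw' (h.isStationary hX hw') hj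
        (hs j hj) (List.nodup_finRange p) (List.mem_finRange j))
      rw [← map_add_atTop_eq_nat 1, eventually_map]
      filter_upwards [this] with k hk
      rw [Function.iterate_succ_apply', hk, hj]
    · exact eventually_sign_eq hj (tendsto_pi_nhds.1 ht j)
  filter_upwards [eventually_all.2 h1] with k hk
  exact funext hk

theorem StrictlyComplementary.eventually_signVec_istaStep {X : Matrix (Fin n) (Fin p) ℝ}
    (hX : ∀ j, X.col j ≠ 0) {y : Fin n → ℝ} {w : Fin p → ℝ} (hw : ∀ j, 0 < n * w j)
    {βhat : Fin p → ℝ} (h : IsUniqueMinimizer (penLSq X y fun j => n * w j) βhat)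
    (hs : StrictlyComplementary X y w βhat) (β : Fin p → ℝ) :
    ∀ᶠ k in atTop, signVec ((istaStep X y w)^[k] β) = signVec βhat := by
  have ht := h.tendsto_istaStep hX hw β
  have h1 : ∀ j, ∀ᶠ k in atTop,
      Real.sign ((istaStep X y w)^[k] β j) = Real.sign (βhat j) := fun j => by
    by_cases hj : βhat j = 0
    · have hL := specNorm_sq_pos hX j
      have := ht.eventually (eventually_softThreshold_eq_zero (x := βhat)
        (f := fun β : Fin p → ℝ => β j + X.col j ⬝ᵥ (y - X *ᵥ β) / specNorm X ^ 2)
        (τ := n * w j / specNorm X ^ 2)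
        ((continuous_apply j).add ((continuous_mulVec_residual X y j).div_const _)).continuousAt
        (by
          rw [hj, zero_add, abs_div, abs_of_pos hL]
          exact div_lt_div_of_pos_right (hs j hj) hL))
      rw [← map_add_atTop_eq_nat 1, eventually_map]
      filter_upwards [this] with k hk
      rw [Function.iterate_succ_apply', hj]
      exact congrArg _ hk |>.trans (by rw [Real.sign_zero])
    · exact eventually_sign_eq hj (tendsto_pi_nhds.1 ht j)
  filter_upwards [eventually_all.2 h1] with k hk
  exact funext hk

/-! ### The scaling of the objectives -/

theorem isUniqueMinimizer_penLSq_of_wLassoObj {X : Matrix (Fin n) (Fin p) ℝ}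
    (hX : ∀ j, X.col j ≠ 0) {y : Fin n → ℝ} {lam βhat : Fin p → ℝ}
    (h : IsUniqueMinimizer (wLassoObj X y lam) βhat) :
    IsUniqueMinimizer (penLSq X y fun j => n * Real.exp (lam j)) βhat := by
  rcases isEmpty_or_nonempty (Fin p) with hp | ⟨⟨j₀⟩⟩
  · exact ⟨fun β => by rw [Subsingleton.elim β βhat], fun _ _ => Subsingleton.elim _ _⟩
  have hn : (0 : ℝ) < n := by
    rcases Nat.eq_zero_or_pos n with rfl | hn
    · exact (hX j₀ (Subsingleton.elim _ _)).elim
    · exact_mod_cast hn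
  have he : ∀ β, penLSq X y (fun j => n * Real.exp (lam j)) β = n * wLassoObj X y lam β := by
    intro β
    simp only [penLSq, wLassoObj, mul_add, mul_assoc, Finset.mul_sum]
    congr 1
    refine Finset.sum_congr rfl fun i _ => ?_
    field_simp
  simp only [IsUniqueMinimizer, he, mul_le_mul_iff_right₀ hn]
  exact h

theorem isUniqueMinimizer_penLSq_of_lassoObj {X : Matrix (Fin n) (Fin p) ℝ}
    (hX : ∀ j, X.col j ≠ 0) {y : Fin n → ℝ} {lam : ℝ} {βhat : Fin p → ℝ}
    (h : IsUniqueMinimizer (lassoObj X y lam) βhat) :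
    IsUniqueMinimizer (penLSq X y fun _ => n * Real.exp lam) βhat := by
  refine isUniqueMinimizer_penLSq_of_wLassoObj (lam := fun _ => lam) hX ?_
  have : wLassoObj X y (fun _ => lam) = lassoObj X y lam := by
    ext β; simp [wLassoObj, lassoObj, Finset.mul_sum]
  rwa [this]

theorem natCast_mul_pos_of_col_ne_zero {X : Matrix (Fin n) (Fin p) ℝ} (hX : ∀ j, X.col j ≠ 0)
    {w : Fin p → ℝ} (hw : ∀ j, 0 < w j) (j : Fin p) : 0 < n * w j := by
  rcases Nat.eq_zero_or_pos n with rfl | hn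
  · exact (hX j (Subsingleton.elim _ _)).elim
  · have := hw j
    positivity

/-! ### Restriction to the support -/

theorem mulVec_eq_colsOn_mulVec (X : Matrix (Fin n) (Fin p) ℝ) {S : Finset (Fin p)}
    {x : Fin p → ℝ} (hx : ∀ j, j ∉ S → x j = 0) :
    X *ᵥ x = colsOn X S *ᵥ fun j : S => x j := by
  ext i
  simp only [mulVec, dotProduct, colsOn, submatrix_apply, id]
  rw [Finset.sum_coe_sort S fun j => X i j * x j]
  symm
  exact Finset.sum_subset (Finset.subset_univ S) fun j _ hj => by simp [hx j hj]

theorem gramOn_mulVec_apply (X : Matrix (Fin n) (Fin p) ℝ) (S : Finset (Fin p)) (u : S → ℝ)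
    (j : S) : (gramOn X S *ᵥ u) j = X.col j ⬝ᵥ (colsOn X S *ᵥ u) := by
  rw [gramOn, ← mulVec_mulVec]
  rfl

theorem gramOn_diag (X : Matrix (Fin n) (Fin p) ℝ) (S : Finset (Fin p)) (j : S) :
    gramOn X S j j = colSq X j := by
  simp [gramOn, colsOn, colSq, Matrix.mul_apply, pow_two]

theorem gramOn_posSemidef (X : Matrix (Fin n) (Fin p) ℝ) (S : Finset (Fin p)) :
    (gramOn X S).PosSemidef := by
  simpa [gramOn] using posSemidef_conjTranspose_mul_self (colsOn X S)

theorem dotProduct_gramOn_mulVec (X : Matrix (Fin n) (Fin p) ℝ) (S : Finset (Fin p))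
    (u : S → ℝ) : u ⬝ᵥ (gramOn X S *ᵥ u) = ∑ i, (colsOn X S *ᵥ u) i ^ 2 := by
  rw [gramOn, ← mulVec_mulVec, dotProduct_mulVec, vecMul_transpose]
  simp [dotProduct, pow_two]

/-- Uniqueness of the minimizer forces the columns on its support to be independent. -/
theorem IsUniqueMinimizer.gramOn_posDef {X : Matrix (Fin n) (Fin p) ℝ}
    {y : Fin n → ℝ} {τ βhat : Fin p → ℝ} (h : IsUniqueMinimizer (penLSq X y τ) βhat) :
    (gramOn X (supp βhat)).PosDef := by
  have hinj : Function.Injective (colsOn X (supp βhat)).mulVec := by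
    refine (injective_iff_map_eq_zero (colsOn X (supp βhat)).mulVecLin).2 fun u hu => ?_
    rw [mulVecLin_apply] at hu
    set δ : Fin p → ℝ := fun j => if hj : j ∈ supp βhat then u ⟨j, hj⟩ else 0 with hδ
    have hδ0 : ∀ j, j ∉ supp βhat → δ j = 0 := fun j hj => by simp [hδ, hj]
    have hXδ : X *ᵥ δ = 0 := by
      rw [mulVec_eq_colsOn_mulVec X hδ0, ← hu]
      congr 1
      ext j; simp [hδ]
    have habs : ∀ j, ∀ᶠ t in 𝓝 (0 : ℝ),
        |βhat j + t * δ j| - |βhat j| = t * (Real.sign (βhat j) * δ j) := fun j => by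
      by_cases hj : βhat j = 0
      · have : δ j = 0 := hδ0 j (by simp [supp, hj])
        simp [this]
      · have hc : Tendsto (fun t : ℝ => βhat j + t * δ j) (𝓝 0) (𝓝 (βhat j)) := by
          have : Continuous fun t : ℝ => βhat j + t * δ j := by fun_prop
          simpa using this.tendsto 0
        have hs : ∀ x : ℝ, |x| = Real.sign x * x := fun x => by
          rcases lt_trichotomy x 0 with h | h | h
          · rw [Real.sign_of_neg h, abs_of_neg h]; ring
          · simp [h]
          · rw [Real.sign_of_pos h, abs_of_pos h]; ring
        filter_upwards [eventually_sign_eq hj hc] with t ht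
        rw [hs, ht, hs (βhat j)]; ring
    set c : ℝ := ∑ j, (τ j * Real.sign (βhat j) - X.col j ⬝ᵥ (y - X *ᵥ βhat)) * δ j with hcdef
    have hlin : ∀ᶠ t in 𝓝 (0 : ℝ),
        penLSq X y τ (βhat + t • δ) - penLSq X y τ βhat = t * c := by
      filter_upwards [eventually_all.2 habs] with t ht
      rw [penLSq_add, mulVec_smul, hXδ, smul_zero, hcdef]
      simp only [Pi.zero_apply, Pi.add_apply, Pi.smul_apply, smul_eq_mul, ht]
      simp only [ne_eq, OfNat.ofNat_ne_zero, not_false_eq_true, zero_pow, Finset.sum_const_zero,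
        mul_zero, zero_add]
      rw [Finset.mul_sum]
      exact Finset.sum_congr rfl fun j _ => by ring
    have hneg : Tendsto (fun t : ℝ => -t) (𝓝 0) (𝓝 0) := by
      simpa using (continuous_neg (G := ℝ)).tendsto 0
    obtain ⟨t, ⟨ht1, ht2⟩, ht0⟩ :=
      ((((hlin.and (hneg.eventually hlin)).filter_mono nhdsWithin_le_nhds).and
        self_mem_nhdsWithin : ∀ᶠ t in 𝓝[≠] (0 : ℝ), _)).exists
    have h1 := h.1 (βhat + t • δ)
    have h2 := h.1 (βhat + (-t) • δ)
    have h3 : penLSq X y τ (βhat + t • δ) = penLSq X y τ βhat := by linarith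
    have h4 := h.2 (βhat + t • δ) fun β => h3.le.trans (h.1 β)
    have h5 : t • δ = 0 := by simpa using h4
    have h6 : δ = 0 := (smul_eq_zero.1 h5).resolve_left ht0
    ext j
    have := congrFun h6 j
    simpa [hδ] using this
  simpa [gramOn] using PosDef.conjTranspose_mul_self _ hinj

/-! ### Euclidean, spectral and Mahalanobis norms -/

section Norms

variable {ι κ : Type} [Fintype ι] [Fintype κ]

theorem euclNorm_eq_norm (x : ι → ℝ) : euclNorm x = ‖WithLp.toLp 2 x‖ := by
  rw [euclNorm, EuclideanSpace.norm_eq]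
  simp

theorem euclNorm_nonneg (x : ι → ℝ) : 0 ≤ euclNorm x := Real.sqrt_nonneg _

theorem euclNorm_sq (x : ι → ℝ) : euclNorm x ^ 2 = ∑ i, x i ^ 2 :=
  Real.sq_sqrt (Finset.sum_nonneg fun _ _ => sq_nonneg _)

theorem euclNorm_eq_zero {x : ι → ℝ} : euclNorm x = 0 ↔ x = 0 := by
  rw [euclNorm_eq_norm]
  simp

theorem continuous_euclNorm : Continuous (euclNorm : (ι → ℝ) → ℝ) := by
  unfold euclNorm; fun_prop

theorem abs_le_euclNorm (x : ι → ℝ) (i : ι) : |x i| ≤ euclNorm x := by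
  rw [euclNorm]
  refine Real.abs_le_sqrt ?_
  exact Finset.single_le_sum (f := fun i => x i ^ 2) (fun _ _ => sq_nonneg _) (Finset.mem_univ i)

variable [DecidableEq κ]

open scoped Matrix.Norms.L2Operator in
theorem specNorm_nonneg (B : Matrix ι κ ℝ) : 0 ≤ specNorm B := by
  unfold specNorm; exact norm_nonneg _

theorem euclNorm_mulVec_le (B : Matrix ι κ ℝ) (x : κ → ℝ) :
    euclNorm (B *ᵥ x) ≤ specNorm B * euclNorm x := by
  have h := Matrix.l2_opNorm_mulVec B (WithLp.toLp 2 x)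
  rw [euclNorm_eq_norm, euclNorm_eq_norm]
  exact h

open scoped Matrix.Norms.L2Operator in
theorem specNorm_le {B : Matrix ι κ ℝ} {c : ℝ} (hc : 0 ≤ c)
    (h : ∀ x, euclNorm x = 1 → euclNorm (B *ᵥ x) ≤ c) : specNorm B ≤ c := by
  unfold specNorm
  rw [Matrix.l2_opNorm_def]
  refine ContinuousLinearMap.opNorm_le_of_unit_norm hc fun x hx => ?_
  have := h (WithLp.ofLp x) (by rw [euclNorm_eq_norm]; exact hx)
  rw [euclNorm_eq_norm] at this
  exact this

/-- In finite dimension, a matrix that strictly decreases the norm of nonzero vectors has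
spectral norm less than one. -/
theorem specNorm_lt_one {B : Matrix ι κ ℝ} (h : ∀ x, x ≠ 0 → euclNorm (B *ᵥ x) < euclNorm x) :
    specNorm B < 1 := by
  set K : Set (κ → ℝ) := {x | euclNorm x = 1} with hK
  have hKc : IsCompact K := by
    refine (isCompact_univ_pi fun _ => isCompact_Icc (a := (-1 : ℝ)) (b := 1)).of_isClosed_subset
      (isClosed_eq continuous_euclNorm continuous_const) fun x hx j _ => ?_
    have hx1 : euclNorm x = 1 := hx
    exact abs_le.1 ((abs_le_euclNorm x j).trans hx1.le)
  rcases K.eq_empty_or_nonempty with hKe | hKn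
  · refine (specNorm_le le_rfl fun x hx => ?_).trans_lt one_pos
    exact absurd (show x ∈ K from hx) (by simp [hKe])
  · obtain ⟨x₀, hx₀, hmax⟩ := hKc.exists_isMaxOn hKn (f := fun x => euclNorm (B *ᵥ x))
      (continuous_euclNorm.comp
        (Continuous.matrix_mulVec continuous_const continuous_id)).continuousOn
    have hx₀' : euclNorm x₀ = 1 := hx₀
    refine (specNorm_le (euclNorm_nonneg (B *ᵥ x₀)) fun x hx => hmax hx).trans_lt ?_
    rw [← hx₀']
    refine h x₀ fun h0 => ?_
    rw [h0, euclNorm_eq_zero.2 rfl] at hx₀'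
    exact zero_ne_one hx₀'

end Norms

/-- A product of nonexpansive matrices, each with norm equality only at its fixed points. -/
theorem list_prod_nonexpansive {ι : Type} [Fintype ι] [DecidableEq ι] {l : List (Matrix ι ι ℝ)}
    (h : ∀ A ∈ l, ∀ x, euclNorm (A *ᵥ x) ≤ euclNorm x ∧
      (euclNorm (A *ᵥ x) = euclNorm x → A *ᵥ x = x)) (x : ι → ℝ) :
    euclNorm (l.prod *ᵥ x) ≤ euclNorm x ∧
      (euclNorm (l.prod *ᵥ x) = euclNorm x → ∀ A ∈ l, A *ᵥ x = x) := by
  induction l with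
  | nil => simp
  | cons A l ih =>
    have ih' := ih fun A hA => h A (List.mem_cons_of_mem _ hA)
    have hA := h A List.mem_cons_self (l.prod *ᵥ x)
    rw [List.prod_cons, ← mulVec_mulVec]
    refine ⟨hA.1.trans ih'.1, fun he => ?_⟩
    have h1 : euclNorm (l.prod *ᵥ x) = euclNorm x := le_antisymm ih'.1 (he ▸ hA.1)
    have h2 := ih'.2 h1
    have h3 : l.prod *ᵥ x = x := by
      clear ih ih' hA he h1 h
      induction l with
      | nil => simp
      | cons B l ih =>
        rw [List.prod_cons, ← mulVec_mulVec, ih fun A hA => h2 A (List.mem_cons_of_mem _ hA)]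
        exact h2 B List.mem_cons_self
    rw [h3] at hA he
    intro B hB
    rcases List.mem_cons.1 hB with rfl | hB
    · exact hA.2 he
    · exact h2 B hB

open scoped MatrixOrder Matrix.Norms.L2Operator in
theorem gramSqrt_mul_self (X : Matrix (Fin n) (Fin p) ℝ) (S : Finset (Fin p)) :
    gramSqrt X S * gramSqrt X S = gramOn X S :=
  CFC.sqrt_mul_sqrt_self _ (Matrix.nonneg_iff_posSemidef.2 (gramOn_posSemidef X S))

open scoped MatrixOrder Matrix.Norms.L2Operator in
theorem gramSqrt_transpose (X : Matrix (Fin n) (Fin p) ℝ) (S : Finset (Fin p)) :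
    (gramSqrt X S)ᵀ = gramSqrt X S := by
  have := (Matrix.nonneg_iff_posSemidef.1 (CFC.sqrt_nonneg (gramOn X S))).isHermitian
  simpa [IsHermitian, gramSqrt] using this

theorem sum_sq_gramSqrt_mulVec (X : Matrix (Fin n) (Fin p) ℝ) (S : Finset (Fin p))
    (u : S → ℝ) : ∑ j, (gramSqrt X S *ᵥ u) j ^ 2 = u ⬝ᵥ (gramOn X S *ᵥ u) := by
  rw [← gramSqrt_mul_self, ← mulVec_mulVec, dotProduct_mulVec, ← mulVec_transpose,
    gramSqrt_transpose]
  simp [dotProduct, pow_two]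

theorem mahalanobis_gramOn_inv {X : Matrix (Fin n) (Fin p) ℝ} {S : Finset (Fin p)}
    (hM : (gramOn X S).PosDef) (u : S → ℝ) :
    mahalanobis (gramOn X S)⁻¹ u = euclNorm (gramSqrt X S *ᵥ u) := by
  rw [mahalanobis, nonsing_inv_nonsing_inv _ ((isUnit_iff_isUnit_det _).1 hM.isUnit), euclNorm,
    sum_sq_gramSqrt_mulVec]

theorem gramSqrt_mulVec_eq_zero {X : Matrix (Fin n) (Fin p) ℝ} {S : Finset (Fin p)}
    (hM : (gramOn X S).PosDef) {u : S → ℝ} (hu : gramSqrt X S *ᵥ u = 0) : u = 0 := by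
  by_contra hne
  have h1 := hM.dotProduct_mulVec_pos hne
  have h2 := sum_sq_gramSqrt_mulVec X S u
  rw [hu] at h2
  simp only [Pi.zero_apply, ne_eq, OfNat.ofNat_ne_zero, not_false_eq_true, zero_pow,
    Finset.sum_const_zero] at h2
  rw [star_trivial, ← h2] at h1
  exact lt_irrefl _ h1

theorem stepMat_mulVec {X : Matrix (Fin n) (Fin p) ℝ} {S : Finset (Fin p)} {j : S}
    (hj : 0 < colSq X j) (z : S → ℝ) (k : S) :
    (stepMat X S j *ᵥ z) k = z k - gramSqrt X S k j * (gramSqrt X S *ᵥ z) j / colSq X j := by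
  have h := Real.mul_self_sqrt hj.le
  have h0 : Real.sqrt (colSq X j) ≠ 0 := (Real.sqrt_pos.2 hj).ne'
  rw [stepMat, sub_mulVec, one_mulVec, Pi.sub_apply, vecMulVec_mulVec]
  have h1 : (fun a => gramSqrt X S j a / Real.sqrt (colSq X j)) ⬝ᵥ z =
      (gramSqrt X S *ᵥ z) j / Real.sqrt (colSq X j) := by
    simp only [dotProduct, mulVec, Finset.sum_div]
    exact Finset.sum_congr rfl fun _ _ => by ring
  rw [h1]
  congr 1
  simp only [Pi.smul_apply, MulOpposite.smul_eq_mul_unop, MulOpposite.unop_op]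
  rw [div_mul_div_comm, h]

theorem stepMat_nonexpansive {X : Matrix (Fin n) (Fin p) ℝ} {S : Finset (Fin p)} {j : S}
    (hj : 0 < colSq X j) (z : S → ℝ) :
    euclNorm (stepMat X S j *ᵥ z) ^ 2 = euclNorm z ^ 2 - (gramSqrt X S *ᵥ z) j ^ 2 / colSq X j := by
  have hG : ∀ k, gramSqrt X S k j = gramSqrt X S j k := fun k =>
    congrFun (congrFun (gramSqrt_transpose X S) j) k
  have h1 : ∑ k, gramSqrt X S k j ^ 2 = colSq X j := by
    rw [← gramOn_diag, ← gramSqrt_mul_self, Matrix.mul_apply]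
    exact Finset.sum_congr rfl fun k _ => by rw [hG k]; ring
  have h2 : ∑ k, gramSqrt X S k j * z k = (gramSqrt X S *ᵥ z) j := by
    simp only [mulVec, dotProduct, hG]
  rw [euclNorm_sq, euclNorm_sq]
  simp only [stepMat_mulVec hj]
  set a := (gramSqrt X S *ᵥ z) j
  have h3 : ∀ k, (z k - gramSqrt X S k j * a / colSq X j) ^ 2 =
      z k ^ 2 - 2 * a / colSq X j * (gramSqrt X S k j * z k)
        + (a / colSq X j) ^ 2 * gramSqrt X S k j ^ 2 := fun k => by ring
  simp only [h3, Finset.sum_add_distrib, Finset.sum_sub_distrib, ← Finset.mul_sum, h1, h2]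
  field_simp
  ring

theorem bcdRate_nonneg (X : Matrix (Fin n) (Fin p) ℝ) (S : Finset (Fin p)) : 0 ≤ bcdRate X S :=
  specNorm_nonneg _

theorem bcdRate_lt_one {X : Matrix (Fin n) (Fin p) ℝ} (hX : ∀ j, X.col j ≠ 0)
    {S : Finset (Fin p)} (hM : (gramOn X S).PosDef) : bcdRate X S < 1 := by
  have hstep : ∀ (j : S) (x : S → ℝ), euclNorm (stepMat X S j *ᵥ x) ≤ euclNorm x ∧
      (euclNorm (stepMat X S j *ᵥ x) = euclNorm x → (gramSqrt X S *ᵥ x) j = 0) := by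
    intro j x
    have hj := colSq_pos hX j
    have h1 := stepMat_nonexpansive hj x
    refine ⟨?_, fun he => ?_⟩
    · have : 0 ≤ (gramSqrt X S *ᵥ x) j ^ 2 / colSq X j := by positivity
      exact abs_le_of_sq_le_sq' (by linarith) (euclNorm_nonneg x) |>.2
    · rw [he] at h1
      have h2 : (gramSqrt X S *ᵥ x) j ^ 2 / colSq X j = 0 := by linarith
      simpa [hj.ne'] using h2
  have hne : ∀ A ∈ (List.ofFn fun i : Fin S.card => stepMat X S (S.orderIsoOfFin rfl i)).reverse,
      ∀ x, euclNorm (A *ᵥ x) ≤ euclNorm x ∧ (euclNorm (A *ᵥ x) = euclNorm x → A *ᵥ x = x) := by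
    intro A hA x
    rw [List.mem_reverse, List.mem_ofFn] at hA
    obtain ⟨i, rfl⟩ := hA
    refine ⟨(hstep _ x).1, fun he => ?_⟩
    ext k
    rw [stepMat_mulVec (colSq_pos hX _), (hstep _ x).2 he]
    simp
  refine specNorm_lt_one fun x hx => ?_
  have h := list_prod_nonexpansive hne x
  refine lt_of_le_of_ne h.1 fun he => hx ?_
  refine gramSqrt_mulVec_eq_zero hM (funext fun j => ?_)
  have h2 : stepMat X S j *ᵥ x = x := h.2 he _ (by
    rw [List.mem_reverse, List.mem_ofFn]
    exact ⟨(S.orderIsoOfFin rfl).symm j, by simp⟩)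
  exact (hstep j x).2 (by rw [h2])

/-! ### The rate of ISTA -/

section IstaRate

variable (X : Matrix (Fin n) (Fin p) ℝ) (S : Finset (Fin p))

theorem gramOn_quadForm_le (u : S → ℝ) :
    u ⬝ᵥ (gramOn X S *ᵥ u) ≤ specNorm X ^ 2 * ∑ j, u j ^ 2 := by
  set x : Fin p → ℝ := fun j => if hj : j ∈ S then u ⟨j, hj⟩ else 0 with hx
  have h0 : ∀ j, j ∉ S → x j = 0 := fun j hj => by simp [hx, hj]
  have h1 : (fun j : S => x j) = u := by ext j; simp [hx]
  have h2 : ∑ j, x j ^ 2 = ∑ j, u j ^ 2 := by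
    rw [← h1, Finset.sum_coe_sort S fun j => x j ^ 2]
    exact (Finset.sum_subset (Finset.subset_univ S) fun j _ hj => by simp [h0 j hj]).symm
  rw [dotProduct_gramOn_mulVec, ← h2]
  have h3 := sum_sq_mulVec_le X x
  rwa [mulVec_eq_colsOn_mulVec X h0, h1] at h3

theorem gramOn_eigenvalues_le (i : S) :
    (gramOn_posSemidef X S).isHermitian.eigenvalues i ≤ specNorm X ^ 2 := by
  set H := (gramOn_posSemidef X S).isHermitian
  have h1 := gramOn_quadForm_le X S (H.eigenvectorBasis i).ofLp
  have h2 : ∑ j, (H.eigenvectorBasis i).ofLp j ^ 2 = 1 := by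
    rw [← EuclideanSpace.real_norm_sq_eq, H.eigenvectorBasis.norm_eq_one, one_pow]
  rw [H.mulVec_eigenvectorBasis, dotProduct_smul, h2] at h1
  have h3 : (H.eigenvectorBasis i).ofLp ⬝ᵥ (H.eigenvectorBasis i).ofLp = 1 := by
    rw [← h2]; simp [dotProduct, pow_two]
  rw [h3] at h1
  simpa using h1

theorem sInf_spectrum_gramOn_le (i : S) :
    sInf (spectrum ℝ (gramOn X S)) ≤ (gramOn_posSemidef X S).isHermitian.eigenvalues i := by
  rw [(gramOn_posSemidef X S).isHermitian.spectrum_real_eq_range_eigenvalues]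
  exact csInf_le (Set.finite_range _).bddBelow ⟨i, rfl⟩

theorem euclNorm_sub_gramOn_mulVec_le (hX : 0 < specNorm X ^ 2) (u : S → ℝ) :
    euclNorm (u - (specNorm X ^ 2)⁻¹ • (gramOn X S *ᵥ u)) ≤ istaRate X S * euclNorm u := by
  rcases isEmpty_or_nonempty S with hS | ⟨⟨i₀⟩⟩
  · simp [euclNorm]
  set H := (gramOn_posSemidef X S).isHermitian
  set L := specNorm X ^ 2
  have hfac : ∀ i, 0 ≤ 1 - H.eigenvalues i / L ∧ 1 - H.eigenvalues i / L ≤ istaRate X S := by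
    intro i
    refine ⟨sub_nonneg.2 ((div_le_one hX).2 (gramOn_eigenvalues_le X S i)), ?_⟩
    exact sub_le_sub_left (div_le_div_of_nonneg_right (sInf_spectrum_gramOn_le X S i) hX.le) _
  have hr : 0 ≤ istaRate X S := (hfac i₀).1.trans (hfac i₀).2
  have hin : ∀ i (v : S → ℝ), inner ℝ (H.eigenvectorBasis i) (WithLp.toLp 2 v) =
      (H.eigenvectorBasis i).ofLp ⬝ᵥ v := fun i v => by
    rw [EuclideanSpace.inner_eq_star_dotProduct, star_trivial, dotProduct_comm]
  have hco : ∀ i, inner ℝ (H.eigenvectorBasis i) (WithLp.toLp 2 (u - L⁻¹ • (gramOn X S *ᵥ u))) =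
      (1 - H.eigenvalues i / L) * inner ℝ (H.eigenvectorBasis i) (WithLp.toLp 2 u) := fun i => by
    have hT : (gramOn X S)ᵀ = gramOn X S := by simpa [IsHermitian] using H
    rw [hin, hin, dotProduct_sub, dotProduct_smul, dotProduct_mulVec, ← mulVec_transpose, hT,
      H.mulVec_eigenvectorBasis, smul_dotProduct]
    simp only [smul_eq_mul]
    ring
  refine abs_le_of_sq_le_sq' ?_ (mul_nonneg hr (euclNorm_nonneg u)) |>.2
  rw [mul_pow, euclNorm_eq_norm, euclNorm_eq_norm, ← H.eigenvectorBasis.sum_sq_inner_right,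
    ← H.eigenvectorBasis.sum_sq_inner_right, Finset.mul_sum]
  refine Finset.sum_le_sum fun i _ => ?_
  rw [hco, mul_pow]
  exact mul_le_mul_of_nonneg_right (pow_le_pow_left₀ (hfac i).1 (hfac i).2 2) (sq_nonneg _)

variable {X S}

theorem istaRate_mem {j : Fin p} (hj : j ∈ S) (hX : 0 < specNorm X ^ 2)
    (hM : (gramOn X S).PosDef) : 0 ≤ istaRate X S ∧ istaRate X S < 1 := by
  set H := (gramOn_posSemidef X S).isHermitian
  have hle := sInf_spectrum_gramOn_le X S ⟨j, hj⟩
  refine ⟨sub_nonneg.2 ((div_le_one hX).2 (hle.trans (gramOn_eigenvalues_le X S ⟨j, hj⟩))), ?_⟩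
  have hpos : 0 < sInf (spectrum ℝ (gramOn X S)) := by
    have hs := H.spectrum_real_eq_range_eigenvalues
    have : sInf (spectrum ℝ (gramOn X S)) ∈ Set.range H.eigenvalues := by
      rw [hs]
      exact Set.Nonempty.csInf_mem ⟨_, ⟨j, hj⟩, rfl⟩ (Set.finite_range _)
    obtain ⟨i, hi⟩ := this
    rw [← hi]
    exact hM.eigenvalues_pos i
  exact sub_lt_self _ (div_pos hpos hX)

end IstaRate

/-! ### The Jacobian recursions for a fixed sign vector -/

/-- One coordinate step of the Jacobian recursion of coordinate descent, for the sign vector `s`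
and the hyperparameter direction `d`. -/
def jacStep (X : Matrix (Fin n) (Fin p) ℝ) (d s J : Fin p → ℝ) (j : Fin p) : Fin p → ℝ :=
  Function.update J j
    (|s j| * (J j + X.col j ⬝ᵥ (-(X *ᵥ J)) / colSq X j) - d j / colSq X j * s j)

/-- An epoch of the Jacobian recursion of coordinate descent. -/
def jacEpoch (X : Matrix (Fin n) (Fin p) ℝ) (d s : Fin p → ℝ) (l : List (Fin p))
    (J : Fin p → ℝ) : Fin p → ℝ := l.foldl (jacStep X d s) J

/-- The Jacobian recursion of ISTA. -/
def jacIsta (X : Matrix (Fin n) (Fin p) ℝ) (d s J : Fin p → ℝ) : Fin p → ℝ := fun j =>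
  |s j| * (J j - (Xᵀ *ᵥ (X *ᵥ J)) j / specNorm X ^ 2) - d j / specNorm X ^ 2 * s j

/-- The fixed point of the Jacobian recursions. -/
def limJac (X : Matrix (Fin n) (Fin p) ℝ) (S : Finset (Fin p)) (d s : Fin p → ℝ) :
    Fin p → ℝ := fun j =>
  if hj : j ∈ S then -((gramOn X S)⁻¹ *ᵥ fun l : S => d l * s l) ⟨j, hj⟩ else 0

/-- The sign vector `s` has support `S`. -/
def IsSignOn (S : Finset (Fin p)) (s : Fin p → ℝ) : Prop :=
  (∀ j ∈ S, |s j| = 1) ∧ ∀ j, j ∉ S → s j = 0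

theorem isSignOn_signVec (β : Fin p → ℝ) : IsSignOn (supp β) (signVec β) := by
  refine ⟨fun j hj => ?_, fun j hj => ?_⟩
  · have hj : β j ≠ 0 := by simpa [supp] using hj
    rcases Real.sign_apply_eq_of_ne_zero _ hj with h | h <;> simp [signVec, h]
  · have hj : β j = 0 := by simpa [supp] using hj
    simp [signVec, hj]

section Recursion

variable {X : Matrix (Fin n) (Fin p) ℝ} {S : Finset (Fin p)} {d s : Fin p → ℝ}

theorem limJac_of_notMem {j : Fin p} (hj : j ∉ S) : limJac X S d s j = 0 := by
  simp [limJac, hj]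

theorem gramOn_mulVec_limJac (hM : (gramOn X S).PosDef) :
    (gramOn X S *ᵥ fun j : S => limJac X S d s j) = fun j : S => -(d j * s j) := by
  have h : (fun j : S => limJac X S d s j) =
      -((gramOn X S)⁻¹ *ᵥ fun l : S => d l * s l) := by
    ext j; simp [limJac]
  rw [h, mulVec_neg, mulVec_mulVec,
    mul_nonsing_inv _ ((isUnit_iff_isUnit_det _).1 hM.isUnit), one_mulVec]
  rfl

theorem jacStep_eq_zero_of_notMem (hs : IsSignOn S s) {J : Fin p → ℝ}
    (hJ : ∀ j, j ∉ S → J j = 0) (i : Fin p) {j : Fin p} (hj : j ∉ S) :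
    jacStep X d s J i j = 0 := by
  by_cases hij : j = i
  · subst hij
    simp [jacStep, hs.2 j hj]
  · simp [jacStep, hij, hJ j hj]

theorem jacEpoch_eq_zero_of_notMem (hs : IsSignOn S s) (l : List (Fin p)) {J : Fin p → ℝ}
    (hJ : ∀ j, j ∉ S → J j = 0) {j : Fin p} (hj : j ∉ S) : jacEpoch X d s l J j = 0 := by
  induction l generalizing J with
  | nil => exact hJ j hj
  | cons i l ih => exact ih fun j hj => jacStep_eq_zero_of_notMem hs hJ i hj

theorem jacEpoch_eq_zero_of_mem (hs : IsSignOn S s) {l : List (Fin p)} {J : Fin p → ℝ}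
    {j : Fin p} (hj : j ∉ S) (hl : j ∈ l ∨ J j = 0) : jacEpoch X d s l J j = 0 := by
  induction l generalizing J with
  | nil => simpa [jacEpoch] using hl
  | cons i l ih =>
    refine ih (J := jacStep X d s J i) ?_
    by_cases hij : j = i
    · subst hij
      right
      simp [jacStep, hs.2 j hj]
    · rcases hl with hl | hl
      · exact Or.inl ((List.mem_cons.1 hl).resolve_left hij)
      · right
        simp [jacStep, hij, hl]

theorem jacEpoch_filter (hs : IsSignOn S s) (l : List (Fin p)) {J : Fin p → ℝ}
    (hJ : ∀ j, j ∉ S → J j = 0) :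
    jacEpoch X d s l J = jacEpoch X d s (l.filter (· ∈ S)) J := by
  induction l generalizing J with
  | nil => rfl
  | cons i l ih =>
    have h1 : jacEpoch X d s (i :: l) J = jacEpoch X d s l (jacStep X d s J i) := rfl
    rw [h1, ih fun j hj => jacStep_eq_zero_of_notMem hs hJ i hj]
    by_cases hi : i ∈ S
    · rw [List.filter_cons_of_pos (by simpa using hi)]
      rfl
    · rw [List.filter_cons_of_neg (by simpa using hi)]
      congr 1
      ext j
      by_cases hij : j = i
      · subst hij
        rw [jacStep_eq_zero_of_notMem hs hJ j hi, hJ j hi]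
      · simp [jacStep, hij]

theorem filter_mem_finRange (S : Finset (Fin p)) :
    (List.finRange p).filter (· ∈ S) = S.sort := by
  rw [← (List.toFinset_sort (· ≤ ·) ((List.nodup_finRange p).filter _)).2
    ((List.pairwise_le_finRange p).filter _)]
  congr 1
  ext j; simp

theorem map_val_orderIsoOfFin (S : Finset (Fin p)) :
    (List.ofFn fun i : Fin S.card => S.orderIsoOfFin rfl i).map (fun j : S => (j : Fin p)) =
      S.sort := by
  rw [← S.listMap_orderEmbOfFin_finRange rfl, List.map_ofFn, ← List.ofFn_eq_map]
  rfl

/-- The error after a coordinate step, in the geometry of `(X_Sᵀ X_S)^(1/2)`. -/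
theorem gramSqrt_mulVec_jacStep (hM : (gramOn X S).PosDef) (hX : ∀ j, X.col j ≠ 0)
    (hs : IsSignOn S s) {J : Fin p → ℝ} (hJ : ∀ j, j ∉ S → J j = 0) (i : S) :
    (gramSqrt X S *ᵥ fun j : S => jacStep X d s J i j - limJac X S d s j) =
      stepMat X S i *ᵥ (gramSqrt X S *ᵥ fun j : S => J j - limJac X S d s j) := by
  set u : S → ℝ := fun j => J j - limJac X S d s j with hu
  have hMu : (gramOn X S *ᵥ u) i = X.col i ⬝ᵥ (X *ᵥ J) + d i * s i := by
    have h1 : u = (fun j : S => J j) - fun j : S => limJac X S d s j := rfl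
    rw [h1, mulVec_sub, gramOn_mulVec_limJac hM, Pi.sub_apply, gramOn_mulVec_apply,
      ← mulVec_eq_colsOn_mulVec X hJ]
    ring
  have hv : (fun j : S => jacStep X d s J i j - limJac X S d s j) =
      u - Pi.single i ((gramOn X S *ᵥ u) i / colSq X i) := by
    ext j
    by_cases hij : j = i
    · subst hij
      have := (colSq_pos hX j).ne'
      simp only [jacStep, Function.update_self, Pi.sub_apply, Pi.single_eq_same, hu, hs.1 _ j.2,
        dotProduct_neg]
      rw [← hu, hMu]
      ring
    · have hij' : (j : Fin p) ≠ i := fun h => hij (Subtype.ext h)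
      simp [jacStep, hij, hij', hu]
  ext k
  rw [hv, stepMat_mulVec (colSq_pos hX i), mulVec_sub, mulVec_mulVec, gramSqrt_mul_self,
    Pi.sub_apply, mulVec_single]
  simp [div_eq_mul_inv, mul_assoc]

theorem gramSqrt_mulVec_jacEpoch (hM : (gramOn X S).PosDef) (hX : ∀ j, X.col j ≠ 0)
    (hs : IsSignOn S s) (l : List S) {J : Fin p → ℝ} (hJ : ∀ j, j ∉ S → J j = 0) :
    (gramSqrt X S *ᵥ fun j : S =>
      jacEpoch X d s (l.map fun j : S => (j : Fin p)) J j - limJac X S d s j) =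
      (l.map (stepMat X S)).reverse.prod *ᵥ
        (gramSqrt X S *ᵥ fun j : S => J j - limJac X S d s j) := by
  induction l generalizing J with
  | nil => simp [jacEpoch]
  | cons i l ih =>
    have h1 : jacEpoch X d s ((i :: l).map fun j : S => (j : Fin p)) J =
      jacEpoch X d s (l.map fun j : S => (j : Fin p)) (jacStep X d s J i) := rfl
    rw [h1, ih fun j hj => jacStep_eq_zero_of_notMem hs hJ i hj,
      gramSqrt_mulVec_jacStep hM hX hs hJ, List.map_cons, List.reverse_cons, List.prod_append,
      List.prod_singleton, mulVec_mulVec]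

theorem mahalanobis_jacEpoch_sort_le (hM : (gramOn X S).PosDef) (hX : ∀ j, X.col j ≠ 0)
    (hs : IsSignOn S s) {J : Fin p → ℝ} (hJ : ∀ j, j ∉ S → J j = 0) :
    mahalanobis (gramOn X S)⁻¹ (fun j : S => jacEpoch X d s S.sort J j - limJac X S d s j) ≤
      bcdRate X S * mahalanobis (gramOn X S)⁻¹ (fun j : S => J j - limJac X S d s j) := by
  rw [mahalanobis_gramOn_inv hM, mahalanobis_gramOn_inv hM, ← map_val_orderIsoOfFin,
    gramSqrt_mulVec_jacEpoch hM hX hs _ hJ, List.map_ofFn]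
  exact euclNorm_mulVec_le _ _

theorem mahalanobis_jacEpoch_finRange_le (hM : (gramOn X S).PosDef) (hX : ∀ j, X.col j ≠ 0)
    (hs : IsSignOn S s) {J : Fin p → ℝ} (hJ : ∀ j, j ∉ S → J j = 0) :
    mahalanobis (gramOn X S)⁻¹
        (fun j : S => jacEpoch X d s (List.finRange p) J j - limJac X S d s j) ≤
      bcdRate X S * mahalanobis (gramOn X S)⁻¹ (fun j : S => J j - limJac X S d s j) := by
  rw [jacEpoch_filter hs _ hJ, filter_mem_finRange]
  exact mahalanobis_jacEpoch_sort_le hM hX hs hJ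

theorem euclNorm_jacIsta_le (hM : (gramOn X S).PosDef) (hX : ∀ j, X.col j ≠ 0)
    (hs : IsSignOn S s) {J : Fin p → ℝ} (hJ : ∀ j, j ∉ S → J j = 0) :
    euclNorm (fun j : S => jacIsta X d s J j - limJac X S d s j) ≤
      istaRate X S * euclNorm (fun j : S => J j - limJac X S d s j) := by
  rcases isEmpty_or_nonempty S with hS | ⟨⟨j₀⟩⟩
  · simp [euclNorm]
  have hv : (fun j : S => jacIsta X d s J j - limJac X S d s j) =
      (fun j : S => J j - limJac X S d s j) -
        (specNorm X ^ 2)⁻¹ • (gramOn X S *ᵥ fun j : S => J j - limJac X S d s j) := by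
    have h1 : (fun j : S => J j - limJac X S d s j) =
      (fun j : S => J j) - fun j : S => limJac X S d s j := rfl
    rw [h1, mulVec_sub, gramOn_mulVec_limJac hM]
    ext j
    have h2 : (Xᵀ *ᵥ (X *ᵥ J)) j = (gramOn X S *ᵥ fun j : S => J j) j := by
      rw [gramOn_mulVec_apply, ← mulVec_eq_colsOn_mulVec X hJ]
      rfl
    simp only [jacIsta, hs.1 _ j.2, h2, Pi.sub_apply, Pi.smul_apply, smul_eq_mul]
    ring
  rw [hv]
  exact euclNorm_sub_gramOn_mulVec_le X S (specNorm_sq_pos hX j₀) _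

theorem istaRate_nonneg (hM : (gramOn X S).PosDef) (hX : ∀ j, X.col j ≠ 0) :
    0 ≤ istaRate X S := by
  rcases S.eq_empty_or_nonempty with rfl | ⟨j, hj⟩
  · simp [istaRate, spectrum.of_subsingleton]
  · exact (istaRate_mem hj (specNorm_sq_pos hX j) hM).1

/-! ### Linear convergence -/

theorem linearFrom_of_succ_le {e : ℕ → ℝ} {c : ℝ} (hc : 0 ≤ c) {k₀ : ℕ}
    (h : ∀ k, k₀ ≤ k → e (k + 1) ≤ c * e k) : LinearFrom e c k₀ := by
  intro m
  refine ⟨h _ (Nat.le_add_right _ _), ?_⟩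
  induction m with
  | zero => simp
  | succ m ih =>
    calc e (k₀ + m + 1) ≤ c * e (k₀ + m) := h _ (Nat.le_add_right _ _)
      _ ≤ c * (c ^ m * e k₀) := mul_le_mul_of_nonneg_left ih hc
      _ = c ^ (m + 1) * e k₀ := by ring

theorem LinearFrom.tendsto_zero {e : ℕ → ℝ} {c : ℝ} (hc : 0 ≤ c) (hc1 : c < 1) {k₀ : ℕ}
    (h : LinearFrom e c k₀) (he : ∀ k, 0 ≤ e k) : Tendsto e atTop (𝓝 0) := by
  rw [← tendsto_add_atTop_iff_nat k₀]
  have h1 : Tendsto (fun m => c ^ m * e k₀) atTop (𝓝 0) := by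
    simpa using (tendsto_pow_atTop_nhds_zero_of_lt_one hc hc1).mul_const (e k₀)
  refine squeeze_zero (fun _ => he _) (fun m => ?_) h1
  rw [add_comm]
  exact (h m).2

theorem tendsto_of_euclNorm_restrict {J : ℕ → Fin p → ℝ} {Jhat : Fin p → ℝ}
    (hJhat : ∀ j, j ∉ S → Jhat j = 0) (hJ : ∀ᶠ k in atTop, ∀ j, j ∉ S → J k j = 0)
    (h : Tendsto (fun k => euclNorm fun j : S => J k j - Jhat j) atTop (𝓝 0)) :
    Tendsto J atTop (𝓝 Jhat) := by
  refine tendsto_pi_nhds.2 fun j => ?_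
  by_cases hj : j ∈ S
  · rw [tendsto_iff_norm_sub_tendsto_zero]
    refine squeeze_zero (fun _ => norm_nonneg _) (fun k => ?_) h
    exact abs_le_euclNorm (fun j : S => J k j - Jhat j) ⟨j, hj⟩
  · rw [hJhat j hj]
    refine tendsto_const_nhds.congr' ?_
    filter_upwards [hJ] with k hk
    exact (hk j hj).symm

theorem euclNorm_le_mahalanobis (hM : (gramOn X S).PosDef) :
    ∃ C, ∀ u : S → ℝ, euclNorm u ≤ C * mahalanobis (gramOn X S)⁻¹ u := by
  refine ⟨specNorm ((gramOn X S)⁻¹ * gramSqrt X S), fun u => ?_⟩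
  rw [mahalanobis_gramOn_inv hM]
  refine le_trans (le_of_eq ?_) (euclNorm_mulVec_le _ _)
  rw [mulVec_mulVec, mul_assoc, gramSqrt_mul_self,
    nonsing_inv_mul _ ((isUnit_iff_isUnit_det _).1 hM.isUnit), one_mulVec]

theorem tendsto_of_linearFrom_mahalanobis (hM : (gramOn X S).PosDef) (hX : ∀ j, X.col j ≠ 0)
    {J : ℕ → Fin p → ℝ} {Jhat : Fin p → ℝ} (hJhat : ∀ j, j ∉ S → Jhat j = 0) {k₀ : ℕ}
    (hJ : ∀ k, k₀ ≤ k → ∀ j, j ∉ S → J k j = 0)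
    (h : LinearFrom (fun k => mahalanobis (gramOn X S)⁻¹ fun j : S => J k j - Jhat j)
      (bcdRate X S) k₀) : Tendsto J atTop (𝓝 Jhat) := by
  obtain ⟨C, hC⟩ := euclNorm_le_mahalanobis hM
  refine tendsto_of_euclNorm_restrict hJhat (eventually_atTop.2 ⟨k₀, hJ⟩) ?_
  have h1 := (h.tendsto_zero (bcdRate_nonneg X S) (bcdRate_lt_one hX hM)
    fun k => Real.sqrt_nonneg _).const_mul C
  rw [mul_zero] at h1
  exact squeeze_zero (fun _ => euclNorm_nonneg _) (fun k => hC _) h1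

/-- The decoupled scheme. -/
theorem jacEpoch_sort_linearFrom (hM : (gramOn X S).PosDef) (hX : ∀ j, X.col j ≠ 0)
    (hs : IsSignOn S s) {J : ℕ → Fin p → ℝ} (hJ0 : J 0 = 0)
    (hJ : ∀ k, J (k + 1) = jacEpoch X d s S.sort (J k)) :
    (∀ k j, j ∉ S → J k j = 0) ∧
      LinearFrom (fun k => mahalanobis (gramOn X S)⁻¹ fun j : S => J k j - limJac X S d s j)
        (bcdRate X S) 0 ∧
      Tendsto J atTop (𝓝 (limJac X S d s)) := by
  have h0 : ∀ k j, j ∉ S → J k j = 0 := fun k => by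
    induction k with
    | zero => simp [hJ0]
    | succ k ih =>
      rw [hJ]
      exact fun j hj => jacEpoch_eq_zero_of_notMem hs _ ih hj
  have hlin : LinearFrom
      (fun k => mahalanobis (gramOn X S)⁻¹ fun j : S => J k j - limJac X S d s j)
      (bcdRate X S) 0 := linearFrom_of_succ_le (bcdRate_nonneg X S) fun k _ => by
    simp only [hJ]
    exact mahalanobis_jacEpoch_sort_le hM hX hs (h0 k)
  exact ⟨h0, hlin,
    tendsto_of_linearFrom_mahalanobis hM hX (fun _ => limJac_of_notMem) (fun k _ => h0 k) hlin⟩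

end Recursion

section Schemes

variable {X : Matrix (Fin n) (Fin p) ℝ} {d βhat : Fin p → ℝ} {b J : ℕ → Fin p → ℝ}

/-- Forward differentiation of coordinate descent, after identification of the signs. -/
theorem jacEpoch_signVec_linearFrom (hM : (gramOn X (supp βhat)).PosDef) (hX : ∀ j, X.col j ≠ 0)
    (hJ : ∀ k, J (k + 1) = jacEpoch X d (signVec (b (k + 1))) (List.finRange p) (J k))
    {k₀ : ℕ} (hk₀ : 1 ≤ k₀) (hb : ∀ k, k₀ ≤ k → signVec (b k) = signVec βhat) :
    (∀ k, k₀ ≤ k → ∀ j, j ∉ supp βhat → J k j = 0) ∧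
      LinearFrom (fun k => mahalanobis (gramOn X (supp βhat))⁻¹ fun j : supp βhat =>
        J k j - limJac X (supp βhat) d (signVec βhat) j) (bcdRate X (supp βhat)) k₀ := by
  have hs := isSignOn_signVec βhat
  have h0 : ∀ k, k₀ ≤ k → ∀ j, j ∉ supp βhat → J k j = 0 := fun k hk j hj => by
    obtain ⟨k, rfl⟩ : ∃ m, k = m + 1 := ⟨k - 1, by omega⟩
    rw [hJ, hb _ hk]
    exact jacEpoch_eq_zero_of_mem hs hj (Or.inl (List.mem_finRange j))
  refine ⟨h0, linearFrom_of_succ_le (bcdRate_nonneg _ _) fun k hk => ?_⟩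
  simp only [hJ, hb (k + 1) (by omega)]
  exact mahalanobis_jacEpoch_finRange_le hM hX hs (h0 k hk)

theorem tendsto_jacEpoch_signVec (hM : (gramOn X (supp βhat)).PosDef) (hX : ∀ j, X.col j ≠ 0)
    (hJ : ∀ k, J (k + 1) = jacEpoch X d (signVec (b (k + 1))) (List.finRange p) (J k))
    (hb : Tendsto b atTop (𝓝 βhat)) (hS : ∀ᶠ k in atTop, supp (b k) = supp βhat) :
    Tendsto J atTop (𝓝 (limJac X (supp βhat) d (signVec βhat))) := by
  obtain ⟨k₀, hk₀⟩ := eventually_atTop.1 (signVec_eq_of_supp_eq hb hS)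
  obtain ⟨h0, hlin⟩ := jacEpoch_signVec_linearFrom hM hX hJ (le_add_self : 1 ≤ k₀ + 1)
    fun k hk => hk₀ k (by omega)
  exact tendsto_of_linearFrom_mahalanobis hM hX (fun _ => limJac_of_notMem) h0 hlin

/-- Forward differentiation of ISTA, after identification of the signs. -/
theorem jacIsta_signVec_linearFrom (hM : (gramOn X (supp βhat)).PosDef) (hX : ∀ j, X.col j ≠ 0)
    (hJ : ∀ k, J (k + 1) = jacIsta X d (signVec (b (k + 1))) (J k))
    {k₀ : ℕ} (hk₀ : 1 ≤ k₀) (hb : ∀ k, k₀ ≤ k → signVec (b k) = signVec βhat) :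
    (∀ k, k₀ ≤ k → ∀ j, j ∉ supp βhat → J k j = 0) ∧
      LinearFrom (fun k => euclNorm fun j : supp βhat =>
        J k j - limJac X (supp βhat) d (signVec βhat) j) (istaRate X (supp βhat)) k₀ := by
  have hs := isSignOn_signVec βhat
  have h0 : ∀ k, k₀ ≤ k → ∀ j, j ∉ supp βhat → J k j = 0 := fun k hk j hj => by
    obtain ⟨k, rfl⟩ : ∃ m, k = m + 1 := ⟨k - 1, by omega⟩
    rw [hJ, hb _ hk]
    simp [jacIsta, hs.2 j hj]
  refine ⟨h0, linearFrom_of_succ_le (istaRate_nonneg hM hX) fun k hk => ?_⟩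
  simp only [hJ, hb (k + 1) (by omega)]
  exact euclNorm_jacIsta_le hM hX hs (h0 k hk)

theorem tendsto_jacIsta_signVec (hM : (gramOn X (supp βhat)).PosDef) (hX : ∀ j, X.col j ≠ 0)
    (hJ : ∀ k, J (k + 1) = jacIsta X d (signVec (b (k + 1))) (J k))
    (hb : Tendsto b atTop (𝓝 βhat)) (hS : ∀ᶠ k in atTop, supp (b k) = supp βhat) :
    Tendsto J atTop (𝓝 (limJac X (supp βhat) d (signVec βhat))) := by
  obtain ⟨k₀, hk₀⟩ := eventually_atTop.1 (signVec_eq_of_supp_eq hb hS)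
  obtain ⟨h0, hlin⟩ := jacIsta_signVec_linearFrom hM hX hJ (le_add_self : 1 ≤ k₀ + 1)
    fun k hk => hk₀ k (by omega)
  refine tendsto_of_euclNorm_restrict (fun _ => limJac_of_notMem)
    (eventually_atTop.2 ⟨_, h0⟩) ?_
  rcases (supp βhat).eq_empty_or_nonempty with hS | ⟨j, hj⟩
  · refine tendsto_const_nhds.congr fun k => ?_
    have : IsEmpty (supp βhat) := by rw [hS]; infer_instance
    simp [euclNorm]
  · have hr := istaRate_mem hj (specNorm_sq_pos hX j) hM
    exact hlin.tendsto_zero hr.1 hr.2 fun k => euclNorm_nonneg _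

end Schemes

/-! ### The schemes as Jacobian recursions -/

/-- Coordinate step of the coefficients together with the Jacobian in direction `d`. -/
def fwdStep (X : Matrix (Fin n) (Fin p) ℝ) (y : Fin n → ℝ) (w d : Fin p → ℝ)
    (s : (Fin p → ℝ) × (Fin p → ℝ)) (j : Fin p) : (Fin p → ℝ) × (Fin p → ℝ) :=
  (bcdUpdate X y w j s.1, jacStep X d (signVec (bcdUpdate X y w j s.1)) s.2 j)

theorem foldl_fwdStep (X : Matrix (Fin n) (Fin p) ℝ) (y : Fin n → ℝ) (w d : Fin p → ℝ)
    {l : List (Fin p)} (hl : l.Nodup) (s : (Fin p → ℝ) × (Fin p → ℝ)) :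
    l.foldl (fwdStep X y w d) s =
      (bcdEpoch X y w l s.1, jacEpoch X d (signVec (bcdEpoch X y w l s.1)) l s.2) := by
  induction l generalizing s with
  | nil => rfl
  | cons j l ih =>
    rw [List.nodup_cons] at hl
    rw [List.foldl_cons, ih hl.2]
    have h1 : signVec (bcdEpoch X y w l (bcdUpdate X y w j s.1)) j =
        signVec (bcdUpdate X y w j s.1) j := by
      simp only [signVec, bcdEpoch_apply_of_notMem X y w hl.1]
    have h2 : jacStep X d (signVec (bcdUpdate X y w j s.1)) s.2 j =
        jacStep X d (signVec (bcdEpoch X y w l (bcdUpdate X y w j s.1))) s.2 j := by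
      simp only [jacStep, h1]
    simp only [fwdStep]
    rw [h2]
    rfl

theorem lassoFwd_succ (X : Matrix (Fin n) (Fin p) ℝ) (y : Fin n → ℝ) (lam : ℝ)
    (β₀ J₀ : Fin p → ℝ) (k : ℕ) :
    lassoFwd X y lam β₀ J₀ (k + 1) =
      (List.finRange p).foldl (fwdStep X y (fun _ => Real.exp lam) fun _ => n * Real.exp lam)
        (lassoFwd X y lam β₀ J₀ k) := by
  rw [lassoFwd, Function.iterate_succ_apply']
  rfl

theorem lassoFwd_fst (X : Matrix (Fin n) (Fin p) ℝ) (y : Fin n → ℝ) (lam : ℝ)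
    (β₀ J₀ : Fin p → ℝ) (k : ℕ) : (lassoFwd X y lam β₀ J₀ k).1 =
      (bcdEpoch X y (fun _ => Real.exp lam) (List.finRange p))^[k] β₀ := by
  induction k with
  | zero => rfl
  | succ k ih =>
    rw [lassoFwd_succ, foldl_fwdStep _ _ _ _ (List.nodup_finRange p), ih,
      Function.iterate_succ_apply']

theorem lassoFwd_snd (X : Matrix (Fin n) (Fin p) ℝ) (y : Fin n → ℝ) (lam : ℝ)
    (β₀ J₀ : Fin p → ℝ) (k : ℕ) : (lassoFwd X y lam β₀ J₀ (k + 1)).2 =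
      jacEpoch X (fun _ => n * Real.exp lam) (signVec (lassoFwd X y lam β₀ J₀ (k + 1)).1)
        (List.finRange p) (lassoFwd X y lam β₀ J₀ k).2 := by
  rw [lassoFwd_succ, foldl_fwdStep _ _ _ _ (List.nodup_finRange p)]

theorem lassoIsta_fst (X : Matrix (Fin n) (Fin p) ℝ) (y : Fin n → ℝ) (lam : ℝ)
    (β₀ J₀ : Fin p → ℝ) (k : ℕ) : (lassoIsta X y lam β₀ J₀ k).1 =
      (istaStep X y fun _ => Real.exp lam)^[k] β₀ := by
  induction k with
  | zero => rfl
  | succ k ih =>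
    rw [lassoIsta, Function.iterate_succ_apply', Function.iterate_succ_apply', ← ih]
    rfl

theorem lassoIsta_snd (X : Matrix (Fin n) (Fin p) ℝ) (y : Fin n → ℝ) (lam : ℝ)
    (β₀ J₀ : Fin p → ℝ) (k : ℕ) : (lassoIsta X y lam β₀ J₀ (k + 1)).2 =
      jacIsta X (fun _ => n * Real.exp lam) (signVec (lassoIsta X y lam β₀ J₀ (k + 1)).1)
        (lassoIsta X y lam β₀ J₀ k).2 := by
  rw [lassoIsta, Function.iterate_succ_apply']
  rfl

theorem lassoJac_eq_limJac (X : Matrix (Fin n) (Fin p) ℝ) (lam : ℝ) (βhat : Fin p → ℝ) :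
    lassoJac X lam βhat =
      limJac X (supp βhat) (fun _ => n * Real.exp lam) (signVec βhat) := by
  ext j
  unfold lassoJac limJac
  split_ifs
  · have : (fun l : supp βhat => (n * Real.exp lam) * signVec βhat l) =
        (n * Real.exp lam) • fun l : supp βhat => Real.sign (βhat l) := rfl
    rw [this, mulVec_smul]
    simp
  · rfl

theorem supp_eq_of_signVec_eq {b βhat : Fin p → ℝ} (h : signVec b = signVec βhat) :
    supp b = supp βhat := by
  ext j
  have hj : Real.sign (b j) = Real.sign (βhat j) := congrFun h j
  simp only [supp, Finset.mem_filter, Finset.mem_univ, true_and, ne_eq]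
  rw [← Real.sign_eq_zero_iff, ← Real.sign_eq_zero_iff (r := βhat j), hj]

theorem lassoImpStep_eq_jacStep (X : Matrix (Fin n) (Fin p) ℝ) (lam : ℝ) {b J : Fin p → ℝ}
    (hJ : ∀ j, j ∉ supp b → J j = 0) {j : Fin p} (hj : j ∈ supp b) :
    lassoImpStep X lam b J j = jacStep X (fun _ => n * Real.exp lam) (signVec b) J j := by
  simp only [lassoImpStep, jacStep, (isSignOn_signVec b).1 j hj, one_mul,
    ← mulVec_eq_colsOn_mulVec X hJ, ← add_sub_assoc]
  rfl

theorem foldl_lassoImpStep (X : Matrix (Fin n) (Fin p) ℝ) (lam : ℝ) {b : Fin p → ℝ}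
    {l : List (Fin p)} (hl : ∀ j ∈ l, j ∈ supp b) {J : Fin p → ℝ}
    (hJ : ∀ j, j ∉ supp b → J j = 0) :
    l.foldl (lassoImpStep X lam b) J =
      jacEpoch X (fun _ => n * Real.exp lam) (signVec b) l J := by
  induction l generalizing J with
  | nil => rfl
  | cons j l ih =>
    rw [List.foldl_cons, lassoImpStep_eq_jacStep X lam hJ (hl j List.mem_cons_self),
      ih (fun i hi => hl i (List.mem_cons_of_mem _ hi))
        fun i hi => jacStep_eq_zero_of_notMem (isSignOn_signVec b) hJ j hi]
    rfl

theorem lassoImp_succ (X : Matrix (Fin n) (Fin p) ℝ) (lam : ℝ) (b : Fin p → ℝ) (k : ℕ) :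
    (∀ j, j ∉ supp b → lassoImp X lam b k j = 0) ∧
    lassoImp X lam b (k + 1) =
      jacEpoch X (fun _ => n * Real.exp lam) (signVec b) (supp b).sort (lassoImp X lam b k) := by
  have hstep : ∀ k, (∀ j, j ∉ supp b → lassoImp X lam b k j = 0) →
      lassoImp X lam b (k + 1) = jacEpoch X (fun _ => n * Real.exp lam) (signVec b)
        (supp b).sort (lassoImp X lam b k) := fun k hk => by
    rw [lassoImp, Function.iterate_succ_apply']
    exact foldl_lassoImpStep X lam (fun j hj => (Finset.mem_sort _).1 hj) hk
  suffices h : ∀ j, j ∉ supp b → lassoImp X lam b k j = 0 from ⟨h, hstep k h⟩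
  induction k with
  | zero => simp [lassoImp]
  | succ k ih =>
    rw [hstep k ih]
    exact fun j hj => jacEpoch_eq_zero_of_notMem (isSignOn_signVec b) _ ih hj

/-! ### The weighted Lasso: directional derivatives -/

/-- One coordinate step of the matrix-valued Jacobian recursion, for the sign vector `s`. -/
def matJacStep (X : Matrix (Fin n) (Fin p) ℝ) (lam s : Fin p → ℝ)
    (J : Matrix (Fin p) (Fin p) ℝ) (j : Fin p) : Matrix (Fin p) (Fin p) ℝ :=
  J.updateRow j fun l =>
    |s j| * (J j l + (X.col j ᵥ* (-(X * J))) l / colSq X j)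
      - if l = j then n * Real.exp (lam j) / colSq X j * s j else 0

theorem matJacStep_mulVec (X : Matrix (Fin n) (Fin p) ℝ) (lam s : Fin p → ℝ)
    (J : Matrix (Fin p) (Fin p) ℝ) (j : Fin p) (v : Fin p → ℝ) :
    matJacStep X lam s J j *ᵥ v =
      jacStep X (fun j => n * Real.exp (lam j) * v j) s (J *ᵥ v) j := by
  ext i
  by_cases hij : i = j
  · subst hij
    have h1 : X.col i ⬝ᵥ (-(X *ᵥ (J *ᵥ v))) = (X.col i ᵥ* (-(X * J))) ⬝ᵥ v := by
      rw [mulVec_mulVec, ← neg_mulVec, dotProduct_mulVec]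
    simp only [jacStep, Function.update_self, h1]
    simp only [matJacStep, mulVec, dotProduct, updateRow_self, sub_mul, ite_mul, zero_mul,
      Finset.sum_sub_distrib, Finset.sum_ite_eq', Finset.mem_univ, if_true]
    congr 1
    · rw [Finset.sum_div, ← Finset.sum_add_distrib, Finset.mul_sum]
      exact Finset.sum_congr rfl fun l _ => by ring
    · ring
  · have : (matJacStep X lam s J j *ᵥ v) i = (J *ᵥ v) i := by
      simp [mulVec, matJacStep, updateRow_ne hij]
    rw [this]
    simp [jacStep, hij]

theorem wLassoFwd_mulVec (X : Matrix (Fin n) (Fin p) ℝ) (y : Fin n → ℝ) (lam β₀ : Fin p → ℝ)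
    (J₀ : Matrix (Fin p) (Fin p) ℝ) (v : Fin p → ℝ) (k : ℕ) :
    ((wLassoFwd X y lam β₀ J₀ (k + 1)).1, (wLassoFwd X y lam β₀ J₀ (k + 1)).2 *ᵥ v) =
      (List.finRange p).foldl
        (fwdStep X y (fun j => Real.exp (lam j)) fun j => n * Real.exp (lam j) * v j)
        ((wLassoFwd X y lam β₀ J₀ k).1, (wLassoFwd X y lam β₀ J₀ k).2 *ᵥ v) := by
  have h := List.foldl_hom
    (fun s : (Fin p → ℝ) × Matrix (Fin p) (Fin p) ℝ => (s.1, s.2 *ᵥ v))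
    (g₁ := wLassoFwdStep X y lam)
    (g₂ := fwdStep X y (fun j => Real.exp (lam j)) fun j => n * Real.exp (lam j) * v j)
    (l := List.finRange p) (init := wLassoFwd X y lam β₀ J₀ k) fun s j => by
      refine Prod.ext rfl ?_
      exact (matJacStep_mulVec X lam _ s.2 j v).symm
  rw [h, wLassoFwd, Function.iterate_succ_apply']
  rfl

theorem wLassoFwd_fst (X : Matrix (Fin n) (Fin p) ℝ) (y : Fin n → ℝ) (lam β₀ : Fin p → ℝ)
    (J₀ : Matrix (Fin p) (Fin p) ℝ) (k : ℕ) : (wLassoFwd X y lam β₀ J₀ k).1 =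
      (bcdEpoch X y (fun j => Real.exp (lam j)) (List.finRange p))^[k] β₀ := by
  induction k with
  | zero => rfl
  | succ k ih =>
    have h := congrArg Prod.fst (wLassoFwd_mulVec X y lam β₀ J₀ 0 k)
    rw [foldl_fwdStep _ _ _ _ (List.nodup_finRange p)] at h
    rw [Function.iterate_succ_apply', ← ih]
    exact h

theorem wLassoFwd_snd (X : Matrix (Fin n) (Fin p) ℝ) (y : Fin n → ℝ) (lam β₀ : Fin p → ℝ)
    (J₀ : Matrix (Fin p) (Fin p) ℝ) (v : Fin p → ℝ) (k : ℕ) :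
    (wLassoFwd X y lam β₀ J₀ (k + 1)).2 *ᵥ v =
      jacEpoch X (fun j => n * Real.exp (lam j) * v j)
        (signVec (wLassoFwd X y lam β₀ J₀ (k + 1)).1) (List.finRange p)
        ((wLassoFwd X y lam β₀ J₀ k).2 *ᵥ v) := by
  have h := wLassoFwd_mulVec X y lam β₀ J₀ v k
  rw [foldl_fwdStep _ _ _ _ (List.nodup_finRange p)] at h
  rw [congrArg Prod.fst h]
  exact congrArg Prod.snd h

theorem wLassoIsta_fst (X : Matrix (Fin n) (Fin p) ℝ) (y : Fin n → ℝ) (lam β₀ : Fin p → ℝ)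
    (J₀ : Matrix (Fin p) (Fin p) ℝ) (k : ℕ) : (wLassoIsta X y lam β₀ J₀ k).1 =
      (istaStep X y fun j => Real.exp (lam j))^[k] β₀ := by
  induction k with
  | zero => rfl
  | succ k ih =>
    rw [wLassoIsta, Function.iterate_succ_apply', Function.iterate_succ_apply', ← ih]
    rfl

theorem wLassoIsta_snd (X : Matrix (Fin n) (Fin p) ℝ) (y : Fin n → ℝ) (lam β₀ : Fin p → ℝ)
    (J₀ : Matrix (Fin p) (Fin p) ℝ) (v : Fin p → ℝ) (k : ℕ) :
    (wLassoIsta X y lam β₀ J₀ (k + 1)).2 *ᵥ v =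
      jacIsta X (fun j => n * Real.exp (lam j) * v j)
        (signVec (wLassoIsta X y lam β₀ J₀ (k + 1)).1)
        ((wLassoIsta X y lam β₀ J₀ k).2 *ᵥ v) := by
  have h : ∀ (s : Fin p → ℝ) (J : Matrix (Fin p) (Fin p) ℝ),
      (Matrix.of fun j l => |s j| * (J j l - (Xᵀ * (X * J)) j l / specNorm X ^ 2)
        - if l = j then n * Real.exp (lam j) / specNorm X ^ 2 * s j else 0) *ᵥ v =
      jacIsta X (fun j => n * Real.exp (lam j) * v j) s (J *ᵥ v) := fun s J => by
    ext j
    rw [jacIsta, mulVec_mulVec, mulVec_mulVec, Matrix.mul_assoc]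
    simp only [mulVec, dotProduct, of_apply, sub_mul, ite_mul, zero_mul,
      Finset.sum_sub_distrib, Finset.sum_ite_eq', Finset.mem_univ, if_true]
    congr 1
    · rw [Finset.sum_div, ← Finset.sum_sub_distrib, Finset.mul_sum]
      exact Finset.sum_congr rfl fun l _ => by ring
    · ring
  rw [← h, wLassoIsta, Function.iterate_succ_apply']
  rfl

theorem wLassoJac_mulVec (X : Matrix (Fin n) (Fin p) ℝ) (lam βhat v : Fin p → ℝ) :
    wLassoJac X lam βhat *ᵥ v =
      limJac X (supp βhat) (fun j => n * Real.exp (lam j) * v j) (signVec βhat) := by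
  ext j
  by_cases hj : j ∈ supp βhat
  · have h0 : ∀ l, l ∉ supp βhat → wLassoJac X lam βhat j l * v l = 0 := fun l hl => by
      simp [wLassoJac, hl]
    have h1 : (wLassoJac X lam βhat *ᵥ v) j =
        ∑ l : supp βhat, wLassoJac X lam βhat j l * v l := by
      rw [Finset.sum_coe_sort (supp βhat) fun l => wLassoJac X lam βhat j l * v l]
      exact (Finset.sum_subset (Finset.subset_univ _) fun l _ hl => h0 l hl).symm
    rw [h1]
    simp only [limJac, hj, dif_pos, mulVec, dotProduct, ← Finset.sum_neg_distrib]
    refine Finset.sum_congr rfl fun l _ => ?_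
    simp only [wLassoJac, hj, l.2, and_self, dif_pos, mul_diagonal, signVec]
    ring
  · rw [limJac_of_notMem hj]
    simp [mulVec, dotProduct, wLassoJac, hj]

theorem wLassoImpStep_eq_matJacStep (X : Matrix (Fin n) (Fin p) ℝ) (lam : Fin p → ℝ)
    {b : Fin p → ℝ} {J : Matrix (Fin p) (Fin p) ℝ}
    (hJ : ∀ j l, j ∉ supp b ∨ l ∉ supp b → J j l = 0) {j : Fin p} (hj : j ∈ supp b) :
    wLassoImpStep X lam b J j = matJacStep X lam (signVec b) J j := by
  unfold wLassoImpStep matJacStep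
  refine congrArg (J.updateRow j) (funext fun l => ?_)
  rw [(isSignOn_signVec b).1 j hj, one_mul]
  congr 1
  by_cases hl : l ∈ supp b
  · rw [dif_pos hl]
    congr 2
    have h1 : X *ᵥ J.col l = colsOn X (supp b) *ᵥ fun a : supp b => J a l :=
      mulVec_eq_colsOn_mulVec X fun a ha => hJ a l (Or.inl ha)
    simp only [vecMul, dotProduct]
    refine Finset.sum_congr rfl fun i _ => ?_
    have h2 : (X * J) i l = (colsOn X (supp b) *
        J.submatrix (fun l : supp b => (l : Fin p)) fun l : supp b => (l : Fin p)) i ⟨l, hl⟩ :=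
      congrFun h1 i
    rw [Matrix.neg_apply, Matrix.neg_apply, h2]
  · rw [dif_neg hl]
    have h1 : (X.col j ᵥ* (-(X * J))) l = 0 := by
      simp only [vecMul, dotProduct]
      refine Finset.sum_eq_zero fun i _ => ?_
      have : (X * J) i l = 0 := by
        rw [Matrix.mul_apply]
        exact Finset.sum_eq_zero fun a _ => by rw [hJ a l (Or.inr hl), mul_zero]
      rw [Matrix.neg_apply, this, neg_zero, mul_zero]
    rw [h1, zero_div, add_zero]

theorem wLassoImpStep_eq_zero (X : Matrix (Fin n) (Fin p) ℝ) (lam : Fin p → ℝ)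
    {b : Fin p → ℝ} {J : Matrix (Fin p) (Fin p) ℝ}
    (hJ : ∀ j l, j ∉ supp b ∨ l ∉ supp b → J j l = 0) {i : Fin p} (hi : i ∈ supp b)
    (j l : Fin p) (h : j ∉ supp b ∨ l ∉ supp b) : wLassoImpStep X lam b J i j l = 0 := by
  unfold wLassoImpStep
  by_cases hij : j = i
  · subst hij
    have hl := h.resolve_left (not_not.2 hi)
    have hlj : l ≠ j := fun h => hl (h ▸ hi)
    simp [hl, hlj, hJ j l h]
  · simp [updateRow_ne hij, hJ j l h]

theorem foldl_wLassoImpStep (X : Matrix (Fin n) (Fin p) ℝ) (lam : Fin p → ℝ) {b : Fin p → ℝ}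
    {l : List (Fin p)} (hl : ∀ j ∈ l, j ∈ supp b) {J : Matrix (Fin p) (Fin p) ℝ}
    (hJ : ∀ j l, j ∉ supp b ∨ l ∉ supp b → J j l = 0) :
    (∀ i j, i ∉ supp b ∨ j ∉ supp b → l.foldl (wLassoImpStep X lam b) J i j = 0) ∧
    ∀ v, l.foldl (wLassoImpStep X lam b) J *ᵥ v =
      jacEpoch X (fun j => n * Real.exp (lam j) * v j) (signVec b) l (J *ᵥ v) := by
  induction l generalizing J with
  | nil => exact ⟨hJ, fun v => rfl⟩
  | cons j l ih =>
    have hj := hl j List.mem_cons_self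
    have ih' := ih (fun i hi => hl i (List.mem_cons_of_mem _ hi))
      (wLassoImpStep_eq_zero X lam hJ hj)
    refine ⟨ih'.1, fun v => ?_⟩
    rw [List.foldl_cons, ih'.2, wLassoImpStep_eq_matJacStep X lam hJ hj, matJacStep_mulVec]
    rfl

theorem wLassoImp_succ (X : Matrix (Fin n) (Fin p) ℝ) (lam b : Fin p → ℝ) (k : ℕ) :
    (∀ j l, j ∉ supp b ∨ l ∉ supp b → wLassoImp X lam b k j l = 0) ∧
    ∀ v, wLassoImp X lam b (k + 1) *ᵥ v =
      jacEpoch X (fun j => n * Real.exp (lam j) * v j) (signVec b) (supp b).sort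
        (wLassoImp X lam b k *ᵥ v) := by
  have hs : ∀ k, wLassoImp X lam b (k + 1) =
      (supp b).sort.foldl (wLassoImpStep X lam b) (wLassoImp X lam b k) := fun k => by
    rw [wLassoImp, Function.iterate_succ_apply']
    rfl
  have hmem : ∀ j ∈ (supp b).sort, j ∈ supp b := fun j hj => (Finset.mem_sort _).1 hj
  have h0 : ∀ j l, j ∉ supp b ∨ l ∉ supp b → wLassoImp X lam b k j l = 0 := by
    induction k with
    | zero => exact fun _ _ _ => rfl
    | succ k ih =>
      rw [hs]
      exact (foldl_wLassoImpStep X lam hmem ih).1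
  refine ⟨h0, ?_⟩
  rw [hs]
  exact (foldl_wLassoImpStep X lam hmem h0).2

theorem tendsto_matrix_of_mulVec {J : ℕ → Matrix (Fin p) (Fin p) ℝ}
    {Jhat : Matrix (Fin p) (Fin p) ℝ}
    (h : ∀ v, Tendsto (fun k => J k *ᵥ v) atTop (𝓝 (Jhat *ᵥ v))) :
    Tendsto J atTop (𝓝 Jhat) := by
  refine tendsto_pi_nhds.2 fun j => tendsto_pi_nhds.2 fun l => ?_
  simpa using tendsto_pi_nhds.1 (h (Pi.single l 1)) j

theorem matrix_apply_eq_zero_of_mulVec {J : Matrix (Fin p) (Fin p) ℝ} {j : Fin p}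
    (h : ∀ v, (J *ᵥ v) j = 0) (l : Fin p) : J j l = 0 := by
  simpa using h (Pi.single l 1)

end LassoDiff

end

theorem proposition2 {n p : ℕ} (X : Matrix (Fin n) (Fin p) ℝ) (y : Fin n → ℝ)
    (hX : ∀ j, X.col j ≠ 0) :
    -- the Lasso
    (∀ (lam : ℝ) (βhat : Fin p → ℝ), IsUniqueMinimizer (lassoObj X y lam) βhat →
      (gramOn X (supp βhat)).PosDef ∧ bcdRate X (supp βhat) < 1 ∧
      -- forward differentiation of BCD, from arbitrary starting points
      (∀ β₀ J₀ : Fin p → ℝ,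
        Tendsto (fun k => (lassoFwd X y lam β₀ J₀ k).1) atTop (𝓝 βhat) ∧
        (StrictlyComplementary X y (fun _ => Real.exp lam) βhat →
          ∀ᶠ k in atTop, signVec (lassoFwd X y lam β₀ J₀ k).1 = signVec βhat) ∧
        ((∀ᶠ k in atTop, supp (lassoFwd X y lam β₀ J₀ k).1 = supp βhat) →
          Tendsto (fun k => (lassoFwd X y lam β₀ J₀ k).2) atTop (𝓝 (lassoJac X lam βhat))) ∧
        ∀ k₀, 1 ≤ k₀ →
          (∀ k, k₀ ≤ k → signVec (lassoFwd X y lam β₀ J₀ k).1 = signVec βhat) →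
          (∀ k, k₀ ≤ k → ∀ j, j ∉ supp βhat → (lassoFwd X y lam β₀ J₀ k).2 j = 0) ∧
          LinearFrom
            (fun k => lassoErr X (supp βhat) (lassoFwd X y lam β₀ J₀ k).2 (lassoJac X lam βhat))
            (bcdRate X (supp βhat)) k₀) ∧
      -- decoupled scheme, run with a solver output `b` whose signs are the right ones
      (∀ b : Fin p → ℝ, signVec b = signVec βhat →
        Tendsto (lassoImp X lam b) atTop (𝓝 (lassoJac X lam βhat)) ∧
        (∀ k j, j ∉ supp βhat → lassoImp X lam b k j = 0) ∧
        LinearFrom (fun k => lassoErr X (supp βhat) (lassoImp X lam b k) (lassoJac X lam βhat))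
          (bcdRate X (supp βhat)) 0) ∧
      -- forward differentiation of ISTA, from arbitrary starting points
      ((supp βhat).Nonempty → 0 ≤ istaRate X (supp βhat) ∧ istaRate X (supp βhat) < 1) ∧
      (∀ β₀ J₀ : Fin p → ℝ,
        Tendsto (fun k => (lassoIsta X y lam β₀ J₀ k).1) atTop (𝓝 βhat) ∧
        (StrictlyComplementary X y (fun _ => Real.exp lam) βhat →
          ∀ᶠ k in atTop, signVec (lassoIsta X y lam β₀ J₀ k).1 = signVec βhat) ∧
        ((∀ᶠ k in atTop, supp (lassoIsta X y lam β₀ J₀ k).1 = supp βhat) →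
          Tendsto (fun k => (lassoIsta X y lam β₀ J₀ k).2) atTop (𝓝 (lassoJac X lam βhat))) ∧
        ∀ k₀, 1 ≤ k₀ →
          (∀ k, k₀ ≤ k → signVec (lassoIsta X y lam β₀ J₀ k).1 = signVec βhat) →
          (∀ k, k₀ ≤ k → ∀ j, j ∉ supp βhat → (lassoIsta X y lam β₀ J₀ k).2 j = 0) ∧
          LinearFrom
            (fun k => euclNorm fun j : supp βhat =>
              (lassoIsta X y lam β₀ J₀ k).2 j - lassoJac X lam βhat j)
            (istaRate X (supp βhat)) k₀)) ∧
    -- the weighted Lasso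
    (∀ (lam βhat : Fin p → ℝ), IsUniqueMinimizer (wLassoObj X y lam) βhat →
      (gramOn X (supp βhat)).PosDef ∧ bcdRate X (supp βhat) < 1 ∧
      -- forward differentiation of BCD, from arbitrary starting points
      (∀ (β₀ : Fin p → ℝ) (J₀ : Matrix (Fin p) (Fin p) ℝ),
        Tendsto (fun k => (wLassoFwd X y lam β₀ J₀ k).1) atTop (𝓝 βhat) ∧
        (StrictlyComplementary X y (fun j => Real.exp (lam j)) βhat →
          ∀ᶠ k in atTop, signVec (wLassoFwd X y lam β₀ J₀ k).1 = signVec βhat) ∧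
        ((∀ᶠ k in atTop, supp (wLassoFwd X y lam β₀ J₀ k).1 = supp βhat) →
          Tendsto (fun k => (wLassoFwd X y lam β₀ J₀ k).2) atTop (𝓝 (wLassoJac X lam βhat))) ∧
        ∀ k₀, 1 ≤ k₀ →
          (∀ k, k₀ ≤ k → signVec (wLassoFwd X y lam β₀ J₀ k).1 = signVec βhat) →
          (∀ k, k₀ ≤ k → ∀ j l, j ∉ supp βhat → (wLassoFwd X y lam β₀ J₀ k).2 j l = 0) ∧
          ∀ v : Fin p → ℝ, LinearFrom
            (fun k => wLassoErr X (supp βhat) (wLassoFwd X y lam β₀ J₀ k).2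
              (wLassoJac X lam βhat) v)
            (bcdRate X (supp βhat)) k₀) ∧
      -- decoupled scheme, run with a solver output `b` whose signs are the right ones
      (∀ b : Fin p → ℝ, signVec b = signVec βhat →
        Tendsto (wLassoImp X lam b) atTop (𝓝 (wLassoJac X lam βhat)) ∧
        (∀ k j l, j ∉ supp βhat ∨ l ∉ supp βhat → wLassoImp X lam b k j l = 0) ∧
        ∀ v : Fin p → ℝ, LinearFrom
          (fun k => wLassoErr X (supp βhat) (wLassoImp X lam b k) (wLassoJac X lam βhat) v)
          (bcdRate X (supp βhat)) 0) ∧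
      -- forward differentiation of ISTA, from arbitrary starting points
      ((supp βhat).Nonempty → 0 ≤ istaRate X (supp βhat) ∧ istaRate X (supp βhat) < 1) ∧
      (∀ (β₀ : Fin p → ℝ) (J₀ : Matrix (Fin p) (Fin p) ℝ),
        Tendsto (fun k => (wLassoIsta X y lam β₀ J₀ k).1) atTop (𝓝 βhat) ∧
        (StrictlyComplementary X y (fun j => Real.exp (lam j)) βhat →
          ∀ᶠ k in atTop, signVec (wLassoIsta X y lam β₀ J₀ k).1 = signVec βhat) ∧
        ((∀ᶠ k in atTop, supp (wLassoIsta X y lam β₀ J₀ k).1 = supp βhat) →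
          Tendsto (fun k => (wLassoIsta X y lam β₀ J₀ k).2) atTop (𝓝 (wLassoJac X lam βhat))) ∧
        ∀ k₀, 1 ≤ k₀ →
          (∀ k, k₀ ≤ k → signVec (wLassoIsta X y lam β₀ J₀ k).1 = signVec βhat) →
          (∀ k, k₀ ≤ k → ∀ j l, j ∉ supp βhat → (wLassoIsta X y lam β₀ J₀ k).2 j l = 0) ∧
          ∀ v : Fin p → ℝ, LinearFrom
            (fun k => euclNorm fun j : supp βhat =>
              (((wLassoIsta X y lam β₀ J₀ k).2 - wLassoJac X lam βhat) *ᵥ v) j)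
            (istaRate X (supp βhat)) k₀)) := by
  refine ⟨fun lam βhat hmin => ?_, fun lam βhat hmin => ?_⟩
  · have hw := natCast_mul_pos_of_col_ne_zero hX (w := fun _ => Real.exp lam)
      fun _ => Real.exp_pos lam
    have h := isUniqueMinimizer_penLSq_of_lassoObj hX hmin
    have hM := h.gramOn_posDef
    rw [lassoJac_eq_limJac]
    refine ⟨hM, bcdRate_lt_one hX hM, fun β₀ J₀ => ?_, fun b hb => ?_,
      fun ⟨j, hj⟩ => istaRate_mem hj (specNorm_sq_pos hX j) hM, fun β₀ J₀ => ?_⟩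
    · have ht : Tendsto (fun k => (lassoFwd X y lam β₀ J₀ k).1) atTop (𝓝 βhat) := by
        simpa only [lassoFwd_fst] using h.tendsto_bcdEpoch hX hw β₀
      refine ⟨ht, fun hs => ?_, ?_, fun k₀ hk₀ hk => ?_⟩
      · simpa only [lassoFwd_fst] using hs.eventually_signVec_bcdEpoch hX hw h β₀
      · exact tendsto_jacEpoch_signVec hM hX (lassoFwd_snd X y lam β₀ J₀) ht
      · exact jacEpoch_signVec_linearFrom hM hX (lassoFwd_snd X y lam β₀ J₀) hk₀ hk
    · have hrec := fun k => (lassoImp_succ X lam b k).2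
      rw [supp_eq_of_signVec_eq hb, hb] at hrec
      obtain ⟨h1, h2, h3⟩ := jacEpoch_sort_linearFrom hM hX (isSignOn_signVec βhat)
        (J := lassoImp X lam b) rfl hrec
      exact ⟨h3, h1, h2⟩
    · have ht : Tendsto (fun k => (lassoIsta X y lam β₀ J₀ k).1) atTop (𝓝 βhat) := by
        simpa only [lassoIsta_fst] using h.tendsto_istaStep hX hw β₀
      refine ⟨ht, fun hs => ?_, ?_, fun k₀ hk₀ hk => ?_⟩
      · simpa only [lassoIsta_fst] using hs.eventually_signVec_istaStep hX hw h β₀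
      · exact tendsto_jacIsta_signVec hM hX (lassoIsta_snd X y lam β₀ J₀) ht
      · exact jacIsta_signVec_linearFrom hM hX (lassoIsta_snd X y lam β₀ J₀) hk₀ hk
  · have hw := natCast_mul_pos_of_col_ne_zero hX (w := fun j => Real.exp (lam j))
      fun j => Real.exp_pos (lam j)
    have h := isUniqueMinimizer_penLSq_of_wLassoObj hX hmin
    have hM := h.gramOn_posDef
    simp only [wLassoErr, sub_mulVec, wLassoJac_mulVec, Pi.sub_apply]
    refine ⟨hM, bcdRate_lt_one hX hM, fun β₀ J₀ => ?_, fun b hb => ?_,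
      fun ⟨j, hj⟩ => istaRate_mem hj (specNorm_sq_pos hX j) hM, fun β₀ J₀ => ?_⟩
    · have ht : Tendsto (fun k => (wLassoFwd X y lam β₀ J₀ k).1) atTop (𝓝 βhat) := by
        simpa only [wLassoFwd_fst] using h.tendsto_bcdEpoch hX hw β₀
      refine ⟨ht, fun hs => ?_, fun hS => tendsto_matrix_of_mulVec fun v => ?_,
        fun k₀ hk₀ hk => ?_⟩
      · simpa only [wLassoFwd_fst] using hs.eventually_signVec_bcdEpoch hX hw h β₀
      · rw [wLassoJac_mulVec]
        exact tendsto_jacEpoch_signVec hM hX (wLassoFwd_snd X y lam β₀ J₀ v) ht hS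
      · have hlin := fun v =>
          jacEpoch_signVec_linearFrom hM hX
            (J := fun k => (wLassoFwd X y lam β₀ J₀ k).2 *ᵥ v) (wLassoFwd_snd X y lam β₀ J₀ v) hk₀ hk
        exact ⟨fun k hk j l hj => matrix_apply_eq_zero_of_mulVec
          (fun v => (hlin v).1 k hk j hj) l, fun v => (hlin v).2⟩
    · have hrec := fun v k => (wLassoImp_succ X lam b k).2 v
      have h0 := fun k => (wLassoImp_succ X lam b k).1
      rw [supp_eq_of_signVec_eq hb] at hrec h0
      rw [hb] at hrec
      have hlin := fun v => jacEpoch_sort_linearFrom hM hX (isSignOn_signVec βhat)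
        (J := fun k => wLassoImp X lam b k *ᵥ v) (zero_mulVec v) (hrec v)
      refine ⟨tendsto_matrix_of_mulVec fun v => ?_, h0, fun v => (hlin v).2.1⟩
      rw [wLassoJac_mulVec]
      exact (hlin v).2.2
    · have ht : Tendsto (fun k => (wLassoIsta X y lam β₀ J₀ k).1) atTop (𝓝 βhat) := by
        simpa only [wLassoIsta_fst] using h.tendsto_istaStep hX hw β₀
      refine ⟨ht, fun hs => ?_, fun hS => tendsto_matrix_of_mulVec fun v => ?_,
        fun k₀ hk₀ hk => ?_⟩
      · simpa only [wLassoIsta_fst] using hs.eventually_signVec_istaStep hX hw h β₀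
      · rw [wLassoJac_mulVec]
        exact tendsto_jacIsta_signVec hM hX (wLassoIsta_snd X y lam β₀ J₀ v) ht hS
      · have hlin := fun v =>
          jacIsta_signVec_linearFrom hM hX
            (J := fun k => (wLassoIsta X y lam β₀ J₀ k).2 *ᵥ v) (wLassoIsta_snd X y lam β₀ J₀ v) hk₀ hk
        exact ⟨fun k hk j l hj => matrix_apply_eq_zero_of_mulVec
          (fun v => (hlin v).1 k hk j hj) l, fun v => (hlin v).2⟩
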